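/- Let $n\ge 1$, $0<\alpha<\frac n2$ and $0<q<1$. Write $B(x,r)$ for the open ball in $\mathbb R^n$, let $M^+(\mathbb R^n)$ be the set of nonnegative locally finite Borel measures on $\mathbb R^n$, and let $\mathbf I_{2\alpha}\mu(x)=\int_{\mathbb R^n}|x-y|^{2\alpha-n}\,d\mu(y)\in[0,\infty]$ for $\mu\in M^+(\mathbb R^n)$. For $\sigma\in M^+(\mathbb R^n)$ with $\sigma\neq0$ and a ball $B$, let $\kappa(B)\in[0,\infty]$ be the least constant in $$\Big(\int_B(\mathbf I_{2\alpha}\nu)^q\,d\sigma\Big)^{1/q}\le\kappa(B)\,\nu(\mathbb R^n)\qquad\text{for all }\nu\in M^+(\mathbb R^n),$$ and put $$\mathbf K_{\alpha,2}\sigma(x)=\int_0^\infty\frac{\kappa(B(x,r))^{\frac q{1-q}}}{r^{n-2\alpha}}\,\frac{dr}r,\qquad x\in\mathbb R^n.$$ The equation $(-\Delta)^\alpha u=\sigma u^q$ in $\mathbb R^n$ is understood in integral form (with the normalization constant of the Riesz potential dropped): a solution is a $\sigma$-measurable function $u:\mathbb R^n\to[0,\infty]$ with $u\in L^q_{\rm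 loc}(\mathbb R^n,d\sigma)$ and $u=\mathbf I_{2\alpha}(u^q\,d\sigma)$ everywhere in $\mathbb R^n$; a supersolution is a $\sigma$-measurable function $u:\mathbb R^n\to[0,\infty]$ with $u\in L^q_{\rm loc}(\mathbb R^n,d\sigma)$ and $u\ge\mathbf I_{2\alpha}(u^q\,d\sigma)$ $d\sigma$-a.e. Such a function is nontrivial if it is not equal to $0$ $d\sigma$-a.e. Consider the condition $$\int_1^\infty\frac{\kappa(B(0,r))^{\frac q{1-q}}}{r^{n-2\alpha}}\,\frac{dr}r+\int_1^\infty\frac{\sigma(B(0,r))}{r^{n-2\alpha}}\,\frac{dr}r<\infty.\tag{1.15}$$ There is a constant $c>0$, depending only on $\alpha$, $q$ and $n$, such that the following hold for every $\sigma\in M^+(\mathbb R^n)$ with $\sigma\ne0$. (i) If (1.15) holds, then there is a solution $u$ with $u>0$ everywhere in $\mathbb R^n$ and $\liminf_{x\to\infty}u(x)=0$, such that $$c^{-1}\Big[\mathbf K_{\alpha,2}\sigma+(\mathbf I_{2\alpha}\sigma)^{\frac1{1-q}}\Big]\le u\le c\,\Big[\mathbf K_{\alpha,2}\sigma+(\mathbf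 I_{2\alpha}\sigma)^{\frac1{1-q}}\Big]\quad\text{everywhere in }\mathbb R^n,$$ and $u$ is minimal: $u\le w$ everywhere in $\mathbb R^n$ for every nontrivial solution $w$. (ii) Conversely, if there is a nontrivial supersolution $u$, then (1.15) holds, and $$u\ge c^{-1}\Big[\mathbf K_{\alpha,2}\sigma+(\mathbf I_{2\alpha}\sigma)^{\frac1{1-q}}\Big]$$ holds $d\sigma$-a.e.; it holds everywhere in $\mathbb R^n$ if $u\ge\mathbf I_{2\alpha}(u^q\,d\sigma)$ everywhere in $\mathbb R^n$. -/

import Mathlib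

open MeasureTheory Set Filter
open scoped ENNReal NNReal

noncomputable section

/-- The (unnormalized) Riesz potential `I_{2α} μ (x) = ∫ |x - y|^{2α - n} dμ(y)` on `ℝⁿ`,
with values in `[0, ∞]`; for `2α < n` the kernel is `∞` on the diagonal. -/
def rieszPotential {n : ℕ} (α : ℝ) (μ : Measure (EuclideanSpace ℝ (Fin n)))
    (x : EuclideanSpace ℝ (Fin n)) : ℝ≥0∞ :=
  ∫⁻ y, edist x y ^ (2 * α - (n : ℝ)) ∂μ

/-- The least constant `κ(A) ∈ [0, ∞]` in the localized inequality
`‖I_{2α} ν‖_{L^q(A, dσ)} ≤ κ(A) ν(ℝⁿ)`, for all locally finite Borel measures `ν ≥ 0`. -/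
def kappaConst {n : ℕ} (α q : ℝ) (σ : Measure (EuclideanSpace ℝ (Fin n)))
    (A : Set (EuclideanSpace ℝ (Fin n))) : ℝ≥0∞ :=
  sInf {C : ℝ≥0∞ | ∀ ν : Measure (EuclideanSpace ℝ (Fin n)), IsLocallyFiniteMeasure ν →
    (∫⁻ x in A, rieszPotential α ν x ^ q ∂σ) ^ (1 / q) ≤ C * ν univ}

/-- The intrinsic potential of Wolff type
`K_{α,2} σ (x) = ∫_0^∞ κ(B(x,r))^{q/(1-q)} r^{-(n-2α)} dr/r`. -/
def intrinsicPotential {n : ℕ} (α q : ℝ) (σ : Measure (EuclideanSpace ℝ (Fin n)))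
    (x : EuclideanSpace ℝ (Fin n)) : ℝ≥0∞ :=
  ∫⁻ r in Ioi (0 : ℝ), kappaConst α q σ (Metric.ball x r) ^ (q / (1 - q))
    / ENNReal.ofReal (r ^ ((n : ℝ) - 2 * α)) / ENNReal.ofReal r

/-- Finiteness of the tails at infinity:
`∫_1^∞ κ(B(0,r))^{q/(1-q)} r^{-(n-2α)} dr/r + ∫_1^∞ σ(B(0,r)) r^{-(n-2α)} dr/r < ∞`. -/
def TailsFinite {n : ℕ} (α q : ℝ) (σ : Measure (EuclideanSpace ℝ (Fin n))) : Prop :=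
  (∫⁻ r in Ioi (1 : ℝ), kappaConst α q σ (Metric.ball 0 r) ^ (q / (1 - q))
      / ENNReal.ofReal (r ^ ((n : ℝ) - 2 * α)) / ENNReal.ofReal r)
    + (∫⁻ r in Ioi (1 : ℝ), σ (Metric.ball 0 r)
      / ENNReal.ofReal (r ^ ((n : ℝ) - 2 * α)) / ENNReal.ofReal r) < ∞

/-- The function `K_{α,2} σ + (I_{2α} σ)^{1/(1-q)}`. -/
def boundFunction {n : ℕ} (α q : ℝ) (σ : Measure (EuclideanSpace ℝ (Fin n)))
    (x : EuclideanSpace ℝ (Fin n)) : ℝ≥0∞ :=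
  intrinsicPotential α q σ x + rieszPotential α σ x ^ (1 / (1 - q))

/-- `u : ℝⁿ → [0, ∞]` belongs to `L^q_loc(ℝⁿ, dσ)`. -/
def MemLqLoc {n : ℕ} (q : ℝ) (σ : Measure (EuclideanSpace ℝ (Fin n)))
    (u : EuclideanSpace ℝ (Fin n) → ℝ≥0∞) : Prop :=
  AEMeasurable u σ ∧
    ∀ A : Set (EuclideanSpace ℝ (Fin n)), IsCompact A → ∫⁻ x in A, u x ^ q ∂σ < ∞

/-- `u ≥ 0` is a solution of `(-Δ)^α u = σ u^q` in `ℝⁿ`, in the integral form: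
`u ∈ L^q_loc(dσ)` and `u = I_{2α}(u^q dσ)` at every point. -/
def IsFracSolution {n : ℕ} (α q : ℝ) (σ : Measure (EuclideanSpace ℝ (Fin n)))
    (u : EuclideanSpace ℝ (Fin n) → ℝ≥0∞) : Prop :=
  MemLqLoc q σ u ∧ ∀ x, u x = rieszPotential α (σ.withDensity fun y => u y ^ q) x

/-- `u ≥ 0` is a supersolution of `(-Δ)^α u = σ u^q` in `ℝⁿ`, in the integral form:
`u ∈ L^q_loc(dσ)` and `u ≥ I_{2α}(u^q dσ)` holds `dσ`-almost everywhere. -/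
def IsFracSupersolution {n : ℕ} (α q : ℝ) (σ : Measure (EuclideanSpace ℝ (Fin n)))
    (u : EuclideanSpace ℝ (Fin n) → ℝ≥0∞) : Prop :=
  MemLqLoc q σ u ∧ ∀ᵐ x ∂σ, rieszPotential α (σ.withDensity fun y => u y ^ q) x ≤ u x

/-- `u` is nontrivial: it does not vanish `dσ`-almost everywhere. -/
def IsNontrivial {n : ℕ} (σ : Measure (EuclideanSpace ℝ (Fin n)))
    (u : EuclideanSpace ℝ (Fin n) → ℝ≥0∞) : Prop :=
  ¬ ∀ᵐ x ∂σ, u x = 0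

end

/-! ### Weighted tail integrals over radii -/

section TailIntegral

/-! Write I for the Riesz potential, β = n - 2α, and v = Kσ + (Iσ)^{1/(1-q)} for the bound function.
The layer cake formula Iμ(x) = β ∫_0^∞ μ(B(x,r)) r^{-β} dr/r turns estimates on balls into estimates
on potentials; moving the center of the balls costs only a dilation in r.

Lower bound. Let u be a nontrivial supersolution and ω = u^q dσ. The inequality (Iσ)^{1+t} ≤ C
I((Iσ)^t dσ) (`rieszPotential_rpow_le`) allows a constant lower bound for u on a ball to be
bootstrapped: the exponents of Iσ are 1 + q + ... + q^{k-1}, tending to 1/(1-q), while the initial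
constant is raised to the power q^k and so disappears in the limit. For Kσ, Vitali covering gives a
weak (1,1) bound for Iν/Iω with respect to ω. Kolmogorov's inequality, together with (Iν)^q dσ =
(Iν/u)^q dω and u ≥ Iω, gives κ(B)^{q/(1-q)} ≤ C ω(B) (`kappaConst_rpow_le`), and integration in r
gives Kσ ≤ C Iω.

Upper bound. The point is that I(v^q dσ) ≤ C v, and this is deduced from the lower bound. On B(x,r),
v is at most a constant times the bound function of σ restricted to B(x,2r) plus a tail centered at
x. When κ(B(x,2r)) is finite, the restricted measure has a positive supersolution whose q-mass is at
most a constant times κ(B(x,2r))^{q/(1-q)} (`exists_supersolution_restrict`), and the lower bound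
says that it dominates the restricted bound function. Hence the integral of v^q over B(x,r) is
controlled (`lintegral_ball_boundFunction_rpow_le`), and integration in r closes the estimate.

Solution. A small multiple of (Iσ)^{1/(1-q)} is a subsolution lying below every nontrivial solution.
Iterating f ↦ I(f^q dσ) from it gives an increasing sequence, still below every nontrivial solution
and, since q < 1, below a fixed multiple of v. Its limit is the minimal solution, and the tail
condition makes it locally q-integrable. Conversely, a supersolution is finite somewhere, so Iω is
finite at a point, which forces the tails to be finite. The vanishing lower limit comes from
averaging the potential over large annuli. -/

/-- The integral `∫_a^∞ g(r) r^{-β} dr/r`. -/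
noncomputable def tailIntegral (β : ℝ) (g : ℝ → ℝ≥0∞) (a : ℝ) : ℝ≥0∞ :=
  ∫⁻ r in Ioi a, g r / ENNReal.ofReal (r ^ β) / ENNReal.ofReal r

variable {β : ℝ} {g g₁ g₂ : ℝ → ℝ≥0∞} {a b : ℝ}

theorem tailIntegral_mono (h : ∀ r, a < r → g₁ r ≤ g₂ r) :
    tailIntegral β g₁ a ≤ tailIntegral β g₂ a := by
  refine setLIntegral_mono' measurableSet_Ioi fun r hr => ?_
  gcongr
  exact h r hr

theorem tailIntegral_anti (h : a ≤ b) : tailIntegral β g b ≤ tailIntegral β g a :=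
  lintegral_mono_set (Ioi_subset_Ioi h)

theorem tailIntegral_const_mul (c : ℝ≥0∞) (hc : c ≠ ∞) :
    tailIntegral β (fun r => c * g r) a = c * tailIntegral β g a := by
  unfold tailIntegral
  rw [← lintegral_const_mul' _ _ hc]
  simp only [div_eq_mul_inv, mul_assoc]

theorem tailIntegral_add (hg : Measurable g₁) :
    tailIntegral β (fun r => g₁ r + g₂ r) a = tailIntegral β g₁ a + tailIntegral β g₂ a := by
  unfold tailIntegral
  rw [← lintegral_add_left (by fun_prop)]
  simp only [div_eq_mul_inv, add_mul]

/-- The tool for separating local from global behaviour: small radii are compared with one function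
and large radii with another. -/
theorem tailIntegral_le_add (hb : a ≤ b) (h₁ : ∀ r, a < r → r ≤ b → g r ≤ g₁ r)
    (h₂ : ∀ r, b < r → g r ≤ g₂ r) :
    tailIntegral β g a ≤ tailIntegral β g₁ a + tailIntegral β g₂ b := by
  have : tailIntegral β g a ≤
      (∫⁻ r in Ioc a b, g r / ENNReal.ofReal (r ^ β) / ENNReal.ofReal r) + tailIntegral β g b := by
    unfold tailIntegral
    rw [← Ioc_union_Ioi_eq_Ioi hb]
    exact lintegral_union_le _ _ _
  refine this.trans (add_le_add ?_ (tailIntegral_mono h₂))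
  refine (setLIntegral_mono' measurableSet_Ioc fun r hr => ?_).trans
    (lintegral_mono_set Ioc_subset_Ioi_self)
  gcongr
  exact h₁ r hr.1 hr.2

/-- Since dr/r is invariant under dilations, only the weight r^{-β} contributes a factor. -/
theorem tailIntegral_comp_mul {l : ℝ} (hl : 0 < l) (ha : 0 ≤ a) :
    tailIntegral β (fun r => g (l * r)) a
      = ENNReal.ofReal (l ^ β) * tailIntegral β g (l * a) := by
  have himg : (fun r => l * r) '' Ioi a = Ioi (l * a) := by
    rw [image_mul_left_Ioi hl]
  unfold tailIntegral
  rw [← himg, lintegral_image_eq_lintegral_abs_deriv_mul measurableSet_Ioi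
    (f' := fun _ => l) (fun x _ => by
      simpa using ((hasDerivAt_id x).const_mul l).hasDerivWithinAt)
    (fun x _ y _ h => mul_left_cancel₀ hl.ne' h),
    ← lintegral_const_mul' _ _ ENNReal.ofReal_ne_top]
  refine setLIntegral_congr_fun measurableSet_Ioi fun r hr => ?_
  have hr0 : 0 < r := ha.trans_lt hr
  have h1 : ENNReal.ofReal ((l * r) ^ β) = ENNReal.ofReal (l ^ β) * ENNReal.ofReal (r ^ β) := by
    rw [Real.mul_rpow hl.le hr0.le, ENNReal.ofReal_mul (by positivity)]
  have h2 : ENNReal.ofReal (l * r) = ENNReal.ofReal l * ENNReal.ofReal r :=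
    ENNReal.ofReal_mul hl.le
  have hlb : ENNReal.ofReal (l ^ β) ≠ 0 := by simpa using Real.rpow_pos_of_pos hl β
  have hl0 : ENNReal.ofReal l ≠ 0 := by simpa using hl
  simp only [abs_of_pos hl]
  rw [h1, h2]
  simp only [div_eq_mul_inv]
  rw [ENNReal.mul_inv (Or.inl hlb) (Or.inl ENNReal.ofReal_ne_top),
    ENNReal.mul_inv (Or.inl hl0) (Or.inl ENNReal.ofReal_ne_top)]
  calc g (l * r) * (ENNReal.ofReal (r ^ β))⁻¹ * (ENNReal.ofReal r)⁻¹
      = (ENNReal.ofReal (l ^ β) * (ENNReal.ofReal (l ^ β))⁻¹)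
        * (ENNReal.ofReal l * (ENNReal.ofReal l)⁻¹)
        * (g (l * r) * (ENNReal.ofReal (r ^ β))⁻¹ * (ENNReal.ofReal r)⁻¹) := by
        rw [ENNReal.mul_inv_cancel hlb ENNReal.ofReal_ne_top,
          ENNReal.mul_inv_cancel hl0 ENNReal.ofReal_ne_top, one_mul, one_mul]
    _ = _ := by ring

theorem tailIntegral_one (hβ : 0 < β) (ha : 0 < a) :
    ENNReal.ofReal β * tailIntegral β (fun _ => 1) a = ENNReal.ofReal a ^ (-β) := by
  have h1 : tailIntegral β (fun _ => 1) a = ∫⁻ r in Ioi a, ENNReal.ofReal (r ^ (-β - 1)) := by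
    refine setLIntegral_congr_fun measurableSet_Ioi fun r hr => ?_
    have hr0 : 0 < r := ha.trans hr
    simp only [div_eq_mul_inv]
    rw [one_mul, ← ENNReal.ofReal_inv_of_pos (by positivity), ← ENNReal.ofReal_inv_of_pos hr0,
      ← ENNReal.ofReal_mul (by positivity), Real.rpow_sub hr0, Real.rpow_neg hr0.le,
      Real.rpow_one, div_eq_mul_inv]
  rw [h1, ← ofReal_integral_eq_lintegral_ofReal
    (integrableOn_Ioi_rpow_of_lt (by linarith) ha)
    ((ae_restrict_iff' measurableSet_Ioi).2 (ae_of_all _ fun r hr =>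
      Real.rpow_nonneg (ha.trans hr).le _)), integral_Ioi_rpow_of_lt (by linarith) ha,
    ← ENNReal.ofReal_mul hβ.le, ENNReal.ofReal_rpow_of_pos ha]
  congr 1
  rw [sub_add_cancel]
  field_simp

end TailIntegral

/-! ### Riesz potentials and the layer cake formula -/

section Basic

variable {n : ℕ} {α q : ℝ}

/-- The space `ℝⁿ`. -/
abbrev Rn (n : ℕ) := EuclideanSpace ℝ (Fin n)

/-- The ball B(x,r) contains y exactly when r > |x-y|, so the integral is that of r^{-β} dr/r from
|x-y| on. On the diagonal both sides are infinite. -/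
theorem tailIntegral_indicator_edist {β : ℝ} (hβ : 0 < β) (x y : Rn n) :
    ENNReal.ofReal β * tailIntegral β (fun r => (Metric.ball x r).indicator 1 y) 0
      = edist x y ^ (-β) := by
  have key : tailIntegral β (fun r => (Metric.ball x r).indicator 1 y) 0
      = tailIntegral β (fun _ => 1) (dist x y) := by
    unfold tailIntegral
    rw [← lintegral_indicator measurableSet_Ioi, ← lintegral_indicator measurableSet_Ioi]
    congr 1
    ext r
    by_cases hr : dist x y < r
    · have hr0 : 0 < r := dist_nonneg.trans_lt hr
      have : y ∈ Metric.ball x r := by rwa [Metric.mem_ball, dist_comm]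
      simp [indicator, hr, hr0, dist_comm y x]
    · have : y ∉ Metric.ball x r := by rwa [Metric.mem_ball, dist_comm]
      simp [indicator, hr, dist_comm y x]
  rw [key]
  rcases eq_or_ne x y with rfl | hxy
  · rw [edist_self, ENNReal.zero_rpow_of_neg (by linarith), dist_self, eq_top_iff]
    refine ENNReal.le_of_forall_nnreal_lt fun C _ => ?_
    obtain ⟨a, ha, hC⟩ : ∃ a : ℝ, 0 < a ∧ (C : ℝ) ≤ a ^ (-β) := by
      -- This radius solves a^{-β} = C + 1.
      refine ⟨((C : ℝ) + 1) ^ (-β⁻¹), by positivity, ?_⟩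
      rw [← Real.rpow_mul (by positivity), neg_mul_neg, inv_mul_cancel₀ hβ.ne', Real.rpow_one]
      linarith
    calc (C : ℝ≥0∞) = ENNReal.ofReal C := by simp
      _ ≤ ENNReal.ofReal (a ^ (-β)) := ENNReal.ofReal_le_ofReal hC
      _ = ENNReal.ofReal β * tailIntegral β (fun _ => 1) a := by
        rw [tailIntegral_one hβ ha, ENNReal.ofReal_rpow_of_pos ha]
      _ ≤ _ := by gcongr; exact tailIntegral_anti ha.le
  · rw [tailIntegral_one hβ (dist_pos.2 hxy), edist_dist]

/-- Layer cake representation of the Riesz potential. -/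
theorem rieszPotential_eq_tailIntegral (hαn : 0 < (n : ℝ) - 2 * α) (μ : Measure (Rn n))
    [SFinite μ] (x : Rn n) :
    rieszPotential α μ x = ENNReal.ofReal ((n : ℝ) - 2 * α) *
      tailIntegral ((n : ℝ) - 2 * α) (fun r => μ (Metric.ball x r)) 0 := by
  have h1 : ∀ y, edist x y ^ (2 * α - (n : ℝ)) = ENNReal.ofReal ((n : ℝ) - 2 * α) *
      tailIntegral ((n : ℝ) - 2 * α) (fun r => (Metric.ball x r).indicator 1 y) 0 := fun y => by
    rw [tailIntegral_indicator_edist hαn, neg_sub]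
  unfold rieszPotential
  simp_rw [h1]
  rw [lintegral_const_mul' _ _ ENNReal.ofReal_ne_top]
  congr 1
  have hm : Measurable fun p : Rn n × ℝ => (Metric.ball x p.2).indicator (1 : Rn n → ℝ≥0∞) p.1 := by
    have : MeasurableSet {p : Rn n × ℝ | dist p.1 x < p.2} :=
      measurableSet_lt (by fun_prop) (by fun_prop)
    exact (measurable_one.indicator this : Measurable
      ({p : Rn n × ℝ | dist p.1 x < p.2}.indicator (1 : Rn n × ℝ → ℝ≥0∞)))
  unfold tailIntegral
  rw [lintegral_lintegral_swap]
  · refine lintegral_congr fun r => ?_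
    simp_rw [div_eq_mul_inv, mul_assoc]
    rw [lintegral_mul_const _ ((measurable_one.indicator Metric.isOpen_ball.measurableSet)),
      lintegral_indicator_one Metric.isOpen_ball.measurableSet]
  · refine Measurable.aemeasurable ?_
    show Measurable fun p : Rn n × ℝ => _
    refine Measurable.div (Measurable.div hm ?_) ?_ <;> fun_prop

theorem rieszPotential_mono {μ ν : Measure (Rn n)} (h : μ ≤ ν) (x : Rn n) :
    rieszPotential α μ x ≤ rieszPotential α ν x :=
  lintegral_mono' h le_rfl

theorem measurable_edist_rpow (p : ℝ) :
    Measurable fun z : Rn n × Rn n => edist z.1 z.2 ^ p := by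
  fun_prop

theorem measurable_rieszPotential (μ : Measure (Rn n)) [SFinite μ] :
    Measurable (rieszPotential α μ) :=
  (measurable_edist_rpow _).lintegral_prod_right'

theorem rieszPotential_withDensity {σ : Measure (Rn n)} {f : Rn n → ℝ≥0∞}
    (hf : AEMeasurable f σ) (x : Rn n) :
    rieszPotential α (σ.withDensity f) x = ∫⁻ y, edist x y ^ (2 * α - (n : ℝ)) * f y ∂σ := by
  unfold rieszPotential
  rw [lintegral_withDensity_eq_lintegral_mul₀ hf (by fun_prop)]
  exact lintegral_congr fun y => mul_comm _ _

theorem rieszPotential_pos {μ : Measure (Rn n)} (hαn : 0 < (n : ℝ) - 2 * α) (hμ : μ ≠ 0)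
    (x : Rn n) : 0 < rieszPotential α μ x := by
  unfold rieszPotential
  rw [pos_iff_ne_zero, Ne, lintegral_eq_zero_iff (by fun_prop)]
  intro h
  apply hμ
  rw [← Measure.measure_univ_eq_zero]
  refine measure_mono_null (fun y _ => ?_) h
  show ¬ _ = _
  simp only [Pi.zero_apply, ENNReal.rpow_eq_zero_iff, not_or, not_and, not_lt]
  exact ⟨fun _ => by linarith, fun h => absurd h (edist_ne_top _ _)⟩

end Basic

/-! ### Median radii of finite measures -/

section Median

/-- A finite measure on a metric space has a median radius around every point. -/
theorem exists_median_radius {X : Type*} [PseudoMetricSpace X] [MeasurableSpace X]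
    [OpensMeasurableSpace X] (μ : Measure X) [IsFiniteMeasure μ] (x : X) :
    ∃ r : ℝ, μ univ / 2 ≤ μ (Metric.closedBall x r) ∧ μ univ / 2 ≤ μ {y | r ≤ dist y x} := by
  rcases eq_or_ne (μ univ) 0 with h0 | h0
  · exact ⟨0, by simp [h0], by simp [h0]⟩
  set S : Set ℝ := {r | μ (Metric.ball x r) ≤ μ univ / 2} with hS
  have hS0 : (0 : ℝ) ∈ S := by simp [hS]
  have hhalf : μ univ / 2 < μ univ := ENNReal.half_lt_self h0 (measure_ne_top _ _)
  have hSb : BddAbove S := by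
    have hu : Tendsto (fun k : ℕ => μ (Metric.ball x k)) atTop (nhds (μ univ)) := by
      have := tendsto_measure_iUnion_atTop (μ := μ) (s := fun k : ℕ => Metric.ball x k)
        (fun i j hij => Metric.ball_subset_ball (by exact_mod_cast hij))
      rwa [Metric.iUnion_ball_nat] at this
    obtain ⟨k, hk⟩ := (hu.eventually (lt_mem_nhds hhalf)).exists
    refine ⟨k, fun r hr => ?_⟩
    by_contra! hlt
    exact absurd (hk.trans_le ((measure_mono (Metric.ball_subset_ball hlt.le)).trans hr))
      (lt_irrefl _)
  -- At the supremum, continuity from below keeps the mass of the open ball at most one half of the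
  -- total, and continuity from above makes that of the closed ball at least one half.
  set R := sSup S
  have hlow : μ (Metric.ball x R) ≤ μ univ / 2 := by
    have hU : Metric.ball x R = ⋃ k : ℕ, Metric.ball x (R - 1 / ((k : ℝ) + 1)) := by
      ext y
      simp only [Metric.mem_ball, mem_iUnion]
      constructor
      · intro h
        obtain ⟨k, hk⟩ := exists_nat_one_div_lt (sub_pos.2 h)
        exact ⟨k, by linarith⟩
      · rintro ⟨k, hk⟩
        have : (0 : ℝ) < 1 / ((k : ℝ) + 1) := by positivity
        linarith
    have hmono : Monotone fun k : ℕ => Metric.ball x (R - 1 / ((k : ℝ) + 1)) := fun i j hij =>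
      Metric.ball_subset_ball (sub_le_sub_left (Nat.one_div_le_one_div hij) _)
    rw [hU, hmono.measure_iUnion]
    refine iSup_le fun k => ?_
    have hk : R - 1 / ((k : ℝ) + 1) < R := by
      have : (0 : ℝ) < 1 / ((k : ℝ) + 1) := by positivity
      linarith
    obtain ⟨s, hs, hlt⟩ := exists_lt_of_lt_csSup ⟨0, hS0⟩ hk
    exact (measure_mono (Metric.ball_subset_ball hlt.le)).trans hs
  refine ⟨R, ?_, ?_⟩
  · have hU : Metric.closedBall x R = ⋂ k : ℕ, Metric.ball x (R + 1 / ((k : ℝ) + 1)) := by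
      ext y
      simp only [Metric.mem_ball, Metric.mem_closedBall, mem_iInter]
      constructor
      · intro h k
        have : (0 : ℝ) < 1 / ((k : ℝ) + 1) := by positivity
        linarith
      · intro h
        by_contra! hlt
        obtain ⟨k, hk⟩ := exists_nat_one_div_lt (sub_pos.2 hlt)
        linarith [h k]
    have hanti : Antitone fun k : ℕ => Metric.ball x (R + 1 / ((k : ℝ) + 1)) := fun i j hij =>
      Metric.ball_subset_ball (add_le_add le_rfl (Nat.one_div_le_one_div hij))
    rw [hU, hanti.measure_iInter (fun _ => Metric.isOpen_ball.measurableSet.nullMeasurableSet)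
      ⟨0, measure_ne_top _ _⟩]
    refine le_iInf fun k => ?_
    have : (0 : ℝ) < 1 / ((k : ℝ) + 1) := by positivity
    have hk : R + 1 / ((k : ℝ) + 1) ∉ S := fun h => by linarith [le_csSup hSb h]
    exact (not_le.1 hk).le
  · have hc : {y | R ≤ dist y x} = (Metric.ball x R)ᶜ := by ext y; simp
    rw [hc, measure_compl Metric.isOpen_ball.measurableSet (measure_ne_top _ _)]
    calc μ univ / 2 = μ univ - μ univ / 2 := by
          rw [ENNReal.sub_half (measure_ne_top _ _)]
      _ ≤ _ := tsub_le_tsub_left hlow _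

end Median

theorem ENNReal.rpow_le_rpow_of_exponent_nonpos {a b : ℝ≥0∞} {z : ℝ} (h : a ≤ b) (hz : z ≤ 0) :
    b ^ z ≤ a ^ z := by
  rw [← neg_neg z, ENNReal.rpow_neg, ENNReal.rpow_neg a]
  exact ENNReal.inv_le_inv.2 (ENNReal.rpow_le_rpow h (by linarith))

/-! ### The iterated potential inequality -/

section Iterated

variable {n : ℕ} {α : ℝ}

/-- The measure `|x - y|^{2α - n} dσ(y)`. -/
noncomputable abbrev kernelMeasure (α : ℝ) (σ : Measure (Rn n)) (x : Rn n) : Measure (Rn n) :=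
  σ.withDensity fun y => edist x y ^ (2 * α - (n : ℝ))

/-- If z is at least as far from x as y is, then |y-z| ≤ 2|x-z|, so the kernel centered at x is at
most 2^{n-2α} times the kernel centered at y. -/
theorem kernelMeasure_le_rieszPotential (hαn : 0 < (n : ℝ) - 2 * α) (σ : Measure (Rn n))
    (x y : Rn n) :
    kernelMeasure α σ x {z | dist y x ≤ dist z x} ≤
      2 ^ ((n : ℝ) - 2 * α) * rieszPotential α σ y := by
  have hm : MeasurableSet {z : Rn n | dist y x ≤ dist z x} :=
    measurableSet_le (by fun_prop) (by fun_prop)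
  rw [withDensity_apply _ hm]
  unfold rieszPotential
  rw [← lintegral_const_mul' _ _ (ENNReal.rpow_ne_top_of_nonneg hαn.le (by simp))]
  refine (setLIntegral_mono' hm fun z hz => ?_).trans (setLIntegral_le_lintegral _ _)
  have h1 : edist y z ≤ 2 * edist x z := by
    have hz' : edist y x ≤ edist z x := by
      rw [edist_dist, edist_dist]; exact ENNReal.ofReal_le_ofReal hz
    calc edist y z ≤ edist y x + edist x z := edist_triangle _ _ _
      _ ≤ edist z x + edist x z := by gcongr
      _ = _ := by rw [edist_comm z x, two_mul]
  have h2 : (2 * edist x z) ^ (2 * α - (n : ℝ)) ≤ edist y z ^ (2 * α - (n : ℝ)) :=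
    ENNReal.rpow_le_rpow_of_exponent_nonpos h1 (by linarith)
  calc edist x z ^ (2 * α - (n : ℝ))
      = 2 ^ ((n : ℝ) - 2 * α) * (2 * edist x z) ^ (2 * α - (n : ℝ)) := by
        rcases eq_or_ne (edist x z) 0 with h | h
        · rw [h, mul_zero, ENNReal.zero_rpow_of_neg (by linarith), ENNReal.mul_top]
          exact (ENNReal.rpow_pos (by norm_num) (by simp)).ne'
        · rw [ENNReal.mul_rpow_of_ne_top (by simp) (edist_ne_top _ _), ← mul_assoc,
            ← ENNReal.rpow_add _ _ (by simp) (by simp)]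
          simp
    _ ≤ _ := by gcongr

/-- The iterated potential inequality `(I σ)^{1+t} ≤ C I((I σ)^t dσ)`. -/
theorem rieszPotential_rpow_le (hαn : 0 < (n : ℝ) - 2 * α) (σ : Measure (Rn n)) [SigmaFinite σ]
    {t : ℝ} (ht : 0 ≤ t) (x : Rn n) :
    rieszPotential α σ x ^ (1 + t) ≤ 2 ^ ((1 + t) + ((n : ℝ) - 2 * α) * t) *
      ∫⁻ y, edist x y ^ (2 * α - (n : ℝ)) * rieszPotential α σ y ^ t ∂σ := by
  have hneg : 2 * α - (n : ℝ) < 0 := by linarith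
  rcases eq_or_ne t 0 with rfl | ht0
  · simp only [add_zero, ENNReal.rpow_one, ENNReal.rpow_zero, mul_one, mul_zero]
    exact le_mul_of_one_le_left' (by norm_num)
  have htp : 0 < t := lt_of_le_of_ne ht ht0.symm
  -- If x is an atom, both sides are infinite. Otherwise the kernel is finite σ-a.e., which makes
  -- the kernel measure σ-finite.
  by_cases hx : σ {x} = 0
  swap
  · have h1 : rieszPotential α σ x = ∞ := by
      unfold rieszPotential
      rw [eq_top_iff]
      calc ∞ = ∫⁻ y in {x}, edist x y ^ (2 * α - (n : ℝ)) ∂σ := by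
            rw [lintegral_singleton, edist_self, ENNReal.zero_rpow_of_neg hneg, ENNReal.top_mul hx]
        _ ≤ _ := setLIntegral_le_lintegral _ _
    have h2 : ∫⁻ y, edist x y ^ (2 * α - (n : ℝ)) * rieszPotential α σ y ^ t ∂σ = ∞ := by
      rw [eq_top_iff]
      calc ∞ = ∫⁻ y in {x}, edist x y ^ (2 * α - (n : ℝ)) * rieszPotential α σ y ^ t ∂σ := by
            rw [lintegral_singleton, edist_self, ENNReal.zero_rpow_of_neg hneg, h1,
              ENNReal.top_rpow_of_pos htp, ENNReal.top_mul_top, ENNReal.top_mul hx]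
        _ ≤ _ := setLIntegral_le_lintegral _ _
    rw [h2, ENNReal.mul_top]
    · exact le_top
    · exact (ENNReal.rpow_pos (by norm_num) (by simp)).ne'
  have hfin : ∀ᵐ y ∂σ, edist x y ^ (2 * α - (n : ℝ)) ≠ ∞ := by
    rw [ae_iff]
    refine measure_mono_null (fun y hy => ?_) hx
    have hy' : edist x y ^ (2 * α - (n : ℝ)) = ∞ := by simpa using hy
    rw [ENNReal.rpow_eq_top_iff] at hy'
    rcases hy' with ⟨h, -⟩ | ⟨h, -⟩
    · simpa [eq_comm] using h
    · exact absurd h (edist_ne_top _ _)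
  have hsf : SigmaFinite (kernelMeasure α σ x) :=
    SigmaFinite.withDensity_of_ne_top hfin
  set C : ℝ≥0∞ := 2 ^ ((1 + t) + ((n : ℝ) - 2 * α) * t)
  set J := ∫⁻ y, edist x y ^ (2 * α - (n : ℝ)) * rieszPotential α σ y ^ t ∂σ with hJ
  have h1t : 0 < 1 + t := by linarith
  rw [← ENNReal.le_rpow_inv_iff h1t]
  have huniv : rieszPotential α σ x = kernelMeasure α σ x univ := by
    rw [withDensity_apply _ MeasurableSet.univ, Measure.restrict_univ]; rfl
  rw [huniv]
  -- A median radius needs finite total mass, so the kernel measure is exhausted by sets of finite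
  -- measure.
  refine le_of_forall_lt fun M hM => ?_
  obtain ⟨s, hs, -, hMs, hsfin⟩ := Measure.exists_subset_measure_lt_top MeasurableSet.univ hM
  refine hMs.trans_le ?_
  rw [ENNReal.le_rpow_inv_iff h1t]
  set μ := (kernelMeasure α σ x).restrict s
  have : IsFiniteMeasure μ := ⟨by simpa [μ] using hsfin⟩
  have hμu : μ univ = kernelMeasure α σ x s := by simp [μ]
  rw [← hμu]
  obtain ⟨r, hr1, hr2⟩ := exists_median_radius μ x
  -- Every y in the inner half is no farther from x than the points of the outer half, so the mass
  -- of the outer half bounds Iσ(y) from below. Integrating this over the inner half gives the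
  -- inequality.
  have hkey : ∀ y ∈ Metric.closedBall x r,
      (μ univ / 2) ^ t ≤ (2 ^ ((n : ℝ) - 2 * α) * rieszPotential α σ y) ^ t := fun y hy => by
    refine ENNReal.rpow_le_rpow (hr2.trans ?_) ht
    refine le_trans ?_ (kernelMeasure_le_rieszPotential hαn σ x y)
    refine (Measure.restrict_apply_le _ _).trans (measure_mono fun z hz => ?_)
    exact (Metric.mem_closedBall.1 hy).trans hz
  have hJ' : J = ∫⁻ y, rieszPotential α σ y ^ t ∂(kernelMeasure α σ x) := by
    rw [lintegral_withDensity_eq_lintegral_mul₀ (by fun_prop)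
      ((measurable_rieszPotential σ).pow_const t).aemeasurable]
    rfl
  have hmain : (μ univ / 2) ^ t * (μ univ / 2) ≤ 2 ^ (((n : ℝ) - 2 * α) * t) * J := by
    calc (μ univ / 2) ^ t * (μ univ / 2)
        ≤ (μ univ / 2) ^ t * μ (Metric.closedBall x r) := by gcongr
      _ = ∫⁻ y in Metric.closedBall x r, (μ univ / 2) ^ t ∂μ := by
          rw [setLIntegral_const]
      _ ≤ ∫⁻ y in Metric.closedBall x r, (2 ^ ((n : ℝ) - 2 * α) * rieszPotential α σ y) ^ t ∂μ :=
          setLIntegral_mono' Metric.isClosed_closedBall.measurableSet hkey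
      _ ≤ ∫⁻ y, (2 ^ ((n : ℝ) - 2 * α) * rieszPotential α σ y) ^ t ∂μ :=
          setLIntegral_le_lintegral _ _
      _ ≤ ∫⁻ y, (2 ^ ((n : ℝ) - 2 * α) * rieszPotential α σ y) ^ t ∂(kernelMeasure α σ x) :=
          setLIntegral_le_lintegral _ _
      _ = 2 ^ (((n : ℝ) - 2 * α) * t) * J := by
          simp_rw [ENNReal.mul_rpow_of_nonneg _ _ ht, ← ENNReal.rpow_mul]
          rw [lintegral_const_mul' _ _ (ENNReal.rpow_ne_top_of_nonneg (by positivity) (by simp)),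
            hJ']
  have hsplit : μ univ ^ (1 + t) = 2 ^ (1 + t) * ((μ univ / 2) ^ t * (μ univ / 2)) := by
    calc μ univ ^ (1 + t) = (2 * (μ univ / 2)) ^ (1 + t) := by
          rw [ENNReal.mul_div_cancel (by simp) (by simp)]
      _ = 2 ^ (1 + t) * (μ univ / 2) ^ (1 + t) := ENNReal.mul_rpow_of_nonneg _ _ h1t.le
      _ = _ := by
          rw [add_comm, ENNReal.rpow_add_of_nonneg _ _ ht zero_le_one, ENNReal.rpow_one]
          rw [ENNReal.rpow_add_of_nonneg _ _ ht zero_le_one, ENNReal.rpow_one]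
  rw [hsplit]
  calc _ ≤ 2 ^ (1 + t) * (2 ^ (((n : ℝ) - 2 * α) * t) * J) := by gcongr
    _ = C * J := by
      rw [← mul_assoc, ← ENNReal.rpow_add _ _ (by simp) (by simp)]

end Iterated

/-! ### Lower bound by a power of the potential of σ -/

section LowerBound

variable {n : ℕ} {α q : ℝ}

/-- For a = 0 or a = ∞ the map z ↦ a^z jumps only at z = 0, so a positive exponent is safe even at
these values. -/
theorem ENNReal.continuousAt_const_rpow (a : ℝ≥0∞) {p : ℝ} (hp : 0 < p) :
    ContinuousAt (fun z : ℝ => a ^ z) p := by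
  have hev : ∀ᶠ z : ℝ in nhds p, 0 < z := lt_mem_nhds hp
  rcases eq_or_ne a 0 with rfl | h0
  · refine (continuousAt_const (y := (0 : ℝ≥0∞))).congr ?_
    filter_upwards [hev] with z hz
    rw [ENNReal.zero_rpow_of_pos hz]
  rcases eq_or_ne a ∞ with rfl | ht
  · refine (continuousAt_const (y := (∞ : ℝ≥0∞))).congr ?_
    filter_upwards [hev] with z hz
    rw [ENNReal.top_rpow_of_pos hz]
  · lift a to ℝ≥0 using ht
    have ha : a ≠ 0 := by simpa using h0
    simp_rw [← ENNReal.coe_rpow_of_ne_zero ha]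
    refine ENNReal.continuous_coe.continuousAt.comp ?_
    exact ContinuousAt.comp (f := fun z : ℝ => (a, z)) (g := fun w : ℝ≥0 × ℝ => w.1 ^ w.2)
      (NNReal.continuousAt_rpow (Or.inl ha)) (by fun_prop)

theorem ENNReal.tendsto_rpow_one_of_tendsto_zero {ι : Type*} {l : Filter ι} {a : ℝ≥0∞}
    (ha0 : a ≠ 0) (ha : a ≠ ∞) {f : ι → ℝ} (hf : Tendsto f l (nhds 0)) :
    Tendsto (fun k => a ^ f k) l (nhds 1) := by
  lift a to ℝ≥0 using ha
  have ha' : a ≠ 0 := by simpa using ha0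
  simp_rw [← ENNReal.coe_rpow_of_ne_zero ha']
  have : Tendsto (fun k => a ^ f k) l (nhds (a ^ (0 : ℝ))) :=
    tendsto_const_nhds.nnrpow hf (Or.inl ha')
  rw [NNReal.rpow_zero] at this
  exact ENNReal.tendsto_coe.2 this

theorem withDensity_ne_zero_of_isNontrivial {σ : Measure (Rn n)} {u : Rn n → ℝ≥0∞} (hq : 0 < q)
    (hu : AEMeasurable u σ) (hnt : IsNontrivial σ u) : σ.withDensity (fun y => u y ^ q) ≠ 0 := by
  intro h
  rw [withDensity_eq_zero_iff (hu.pow_const q)] at h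
  refine hnt (h.mono fun x hx => ?_)
  simpa [hq, hq.le, not_lt.2 hq.le] using hx

theorem exists_measure_ball_pos {μ : Measure (Rn n)} (hμ : μ ≠ 0) :
    ∃ k : ℕ, 0 < μ (Metric.ball 0 k) := by
  by_contra! h
  apply hμ
  rw [← Measure.measure_univ_eq_zero, ← Metric.iUnion_ball_nat (0 : Rn n)]
  exact measure_iUnion_null fun k => le_antisymm (h k) zero_le

/-- Restricted to a ball, a nontrivial supersolution is bounded below by a power of the potential
of the restricted measure. -/
theorem rieszPotential_restrict_rpow_le (hαn : 0 < (n : ℝ) - 2 * α) (hq : 0 < q) (hq1 : q < 1)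
    {σ : Measure (Rn n)} [SigmaFinite σ] {u : Rn n → ℝ≥0∞} (hu : AEMeasurable u σ)
    (hsup : ∀ᵐ x ∂σ, rieszPotential α (σ.withDensity fun y => u y ^ q) x ≤ u x)
    {R : ℝ} (hR : 0 < σ.withDensity (fun y => u y ^ q) (Metric.ball 0 R)) (x : Rn n) :
    ((2 ^ ((1 + ((n : ℝ) - 2 * α)) / (1 - q)))⁻¹ *
      rieszPotential α (σ.restrict (Metric.ball 0 R)) x) ^ (1 / (1 - q))
      ≤ rieszPotential α (σ.withDensity fun y => u y ^ q) x := by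
  set β := (n : ℝ) - 2 * α with hβ
  set B : Set (Rn n) := Metric.ball 0 R
  set ω := σ.withDensity fun y => u y ^ q
  set C : ℝ≥0∞ := 2 ^ ((1 + β) / (1 - q)) with hC
  set S := rieszPotential α (σ.restrict B) with hS
  have hq1' : 0 < 1 - q := by linarith
  have hC0 : C ≠ 0 := (ENNReal.rpow_pos (by norm_num) (by simp)).ne'
  have hCt : C ≠ ∞ := ENNReal.rpow_ne_top_of_nonneg (by positivity) (by simp)
  have hCi0 : C⁻¹ ≠ 0 := ENNReal.inv_ne_zero.2 hCt
  have hCit : C⁻¹ ≠ ∞ := ENNReal.inv_ne_top.2 hC0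
  have hR0 : 0 < R := by
    by_contra! h
    have hB : B = ∅ := Metric.ball_eq_empty.2 h
    simp [hB] at hR
  have hBm : MeasurableSet B := Metric.isOpen_ball.measurableSet
  -- Two points of B are at distance less than 2R, which bounds the potential of ω from below on B.
  -- The minimum with 1 keeps the bound finite when ω(B) is infinite.
  set a : ℝ≥0∞ := min 1 (ENNReal.ofReal (2 * R) ^ (2 * α - (n : ℝ)) * ω B) with ha
  have ha0 : a ≠ 0 := by
    have : 0 < ENNReal.ofReal (2 * R) ^ (2 * α - (n : ℝ)) * ω B :=
      ENNReal.mul_pos (ENNReal.rpow_pos (by simpa using hR0) ENNReal.ofReal_ne_top).ne' hR.ne'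
    exact (lt_min one_pos this).ne'
  have hat : a ≠ ∞ := ((min_le_left _ _).trans_lt ENNReal.one_lt_top).ne
  -- The geometric sums 1 + q + ... + q^{k-1}, the exponents of the bootstrap; s 0 = 0 corresponds
  -- to the constant bound a.
  let s : ℕ → ℝ := fun k => (1 - q ^ k) / (1 - q)
  have hs0 : ∀ k, 0 ≤ s k := fun k => div_nonneg (by linarith [pow_le_one₀ (n := k) hq.le hq1.le])
    hq1'.le
  have hss : ∀ k, s (k + 1) = 1 + q * s k := fun k => by
    simp only [s]; field_simp; ring
  have hs1 : ∀ k, q * s k ≤ q / (1 - q) := fun k => by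
    simp only [s]; rw [mul_div_assoc']
    gcongr
    nlinarith [pow_pos hq k]
  have hinit : ∀ y ∈ B, a ≤ rieszPotential α ω y := fun y hy => by
    refine (min_le_right _ _).trans ?_
    calc ENNReal.ofReal (2 * R) ^ (2 * α - (n : ℝ)) * ω B
        = ∫⁻ z in B, ENNReal.ofReal (2 * R) ^ (2 * α - (n : ℝ)) ∂ω := by rw [setLIntegral_const]
      _ ≤ ∫⁻ z in B, edist y z ^ (2 * α - (n : ℝ)) ∂ω := by
          refine setLIntegral_mono' hBm fun z hz => ?_
          refine ENNReal.rpow_le_rpow_of_exponent_nonpos ?_ (by linarith)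
          rw [edist_dist]
          refine ENNReal.ofReal_le_ofReal ?_
          have h1 := Metric.mem_ball.1 hy
          have h2 := Metric.mem_ball.1 hz
          linarith [dist_triangle_right y z 0]
      _ ≤ _ := setLIntegral_le_lintegral _ _
  have hstep : ∀ k, (∀ᵐ y ∂σ, y ∈ B → (C⁻¹ * S y) ^ s k * a ^ (q ^ k) ≤ u y) →
      ∀ y, (C⁻¹ * S y) ^ s (k + 1) * a ^ (q ^ (k + 1)) ≤ rieszPotential α ω y := by
    intro k hk y
    have hk' : ∀ᵐ z ∂(σ.restrict B), (C⁻¹ * S z) ^ s k * a ^ (q ^ k) ≤ u z :=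
      (ae_restrict_iff' hBm).2 hk
    set t := q * s k with ht
    have ht0 : 0 ≤ t := mul_nonneg hq.le (hs0 k)
    have hiter := rieszPotential_rpow_le hαn (σ.restrict B) ht0 y
    -- As t ≤ q/(1-q) for every k, a single constant serves all steps.
    have hCle : (2 : ℝ≥0∞) ^ (1 + t + β * t) ≤ C := by
      refine ENNReal.rpow_le_rpow_of_exponent_le (by norm_num) ?_
      have h1 : (1 + β) / (1 - q) = (1 + β) * (1 + q / (1 - q)) := by field_simp; ring
      rw [h1]
      nlinarith [hs1 k]
    set J := ∫⁻ z, edist y z ^ (2 * α - (n : ℝ)) * S z ^ t ∂(σ.restrict B)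
    have hD : C⁻¹ ^ t * a ^ (q ^ (k + 1)) ≠ ∞ := ENNReal.mul_ne_top
      (ENNReal.rpow_ne_top_of_nonneg ht0 hCit) (ENNReal.rpow_ne_top_of_nonneg (by positivity) hat)
    calc (C⁻¹ * S y) ^ s (k + 1) * a ^ (q ^ (k + 1))
        = C⁻¹ ^ t * a ^ (q ^ (k + 1)) * (C⁻¹ * S y ^ (1 + t)) := by
          rw [hss, ENNReal.mul_rpow_of_nonneg _ _ (by linarith [hs0 k]),
            ENNReal.rpow_add 1 t hCi0 hCit, ENNReal.rpow_one]
          ring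
      _ ≤ C⁻¹ ^ t * a ^ (q ^ (k + 1)) * J := by
          gcongr
          rw [ENNReal.inv_mul_le_iff hC0 hCt]
          exact hiter.trans (by gcongr)
      _ = ∫⁻ z, edist y z ^ (2 * α - (n : ℝ)) * ((C⁻¹ * S z) ^ s k * a ^ (q ^ k)) ^ q
            ∂(σ.restrict B) := by
          rw [← lintegral_const_mul' _ _ hD]
          refine lintegral_congr fun z => ?_
          rw [ENNReal.mul_rpow_of_nonneg _ _ hq.le, ← ENNReal.rpow_mul, ← ENNReal.rpow_mul,
            mul_comm (s k) q, ← ht, ← pow_succ, ENNReal.mul_rpow_of_nonneg _ _ ht0]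
          ring
      _ ≤ ∫⁻ z, edist y z ^ (2 * α - (n : ℝ)) * u z ^ q ∂(σ.restrict B) := by
          refine lintegral_mono_ae (hk'.mono fun z hz => ?_)
          gcongr
      _ ≤ ∫⁻ z, edist y z ^ (2 * α - (n : ℝ)) * u z ^ q ∂σ := setLIntegral_le_lintegral _ _
      _ = _ := (rieszPotential_withDensity (hu.pow_const q) y).symm
  have hall : ∀ k, ∀ᵐ y ∂σ, y ∈ B → (C⁻¹ * S y) ^ s k * a ^ (q ^ k) ≤ u y := by
    intro k
    induction k with
    | zero =>
      filter_upwards [hsup] with y hy hyB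
      simpa [s] using (hinit y hyB).trans hy
    | succ k ih =>
      filter_upwards [hsup] with y hy hyB
      exact (hstep k ih y).trans hy
  -- In the limit a^{q^k} tends to 1, so the final constant depends neither on u nor on the ball.
  have hpow : Tendsto (fun k : ℕ => q ^ k) atTop (nhds 0) :=
    tendsto_pow_atTop_nhds_zero_of_lt_one hq.le hq1
  have hslim : Tendsto (fun k => s (k + 1)) atTop (nhds (1 / (1 - q))) := by
    have : Tendsto s atTop (nhds ((1 - 0) / (1 - q))) := (tendsto_const_nhds.sub hpow).div_const _
    rw [sub_zero] at this
    exact this.comp (tendsto_add_atTop_nat 1)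
  have hlim1 : Tendsto (fun k => (C⁻¹ * S x) ^ s (k + 1)) atTop
      (nhds ((C⁻¹ * S x) ^ (1 / (1 - q)))) :=
    (ENNReal.continuousAt_const_rpow _ (by positivity)).tendsto.comp hslim
  have hlim2 : Tendsto (fun k : ℕ => a ^ (q ^ (k + 1))) atTop (nhds 1) :=
    (ENNReal.tendsto_rpow_one_of_tendsto_zero ha0 hat hpow).comp (tendsto_add_atTop_nat 1)
  have hlim := ENNReal.Tendsto.mul hlim1 (Or.inr ENNReal.one_ne_top) hlim2 (Or.inl one_ne_zero)
  rw [mul_one] at hlim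
  exact le_of_tendsto' hlim fun k => hstep k (hall k) x

/-- Continuity from below of the kernel measure; it removes the restriction to a ball. -/
theorem tendsto_rieszPotential_restrict_ball (σ : Measure (Rn n)) (x : Rn n) :
    Tendsto (fun k : ℕ => rieszPotential α (σ.restrict (Metric.ball 0 k)) x) atTop
      (nhds (rieszPotential α σ x)) := by
  have hmono : Monotone fun k : ℕ => Metric.ball (0 : Rn n) k := fun i j hij =>
    Metric.ball_subset_ball (by exact_mod_cast hij)
  have h := tendsto_measure_iUnion_atTop (μ := kernelMeasure α σ x) hmono
  rw [Metric.iUnion_ball_nat] at h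
  have h1 : ∀ s, MeasurableSet s → kernelMeasure α σ x s = rieszPotential α (σ.restrict s) x :=
    fun s hs => by rw [withDensity_apply _ hs]; rfl
  have h2 : ∀ k : ℕ, kernelMeasure α σ x (Metric.ball 0 k)
      = rieszPotential α (σ.restrict (Metric.ball 0 k)) x :=
    fun k => h1 _ Metric.isOpen_ball.measurableSet
  rw [h1 _ MeasurableSet.univ, Measure.restrict_univ] at h
  simpa only [Function.comp_def, h2] using h

/-- Nontrivial supersolutions are bounded below by `c (I_{2α} σ)^{1/(1-q)}`. -/
theorem rieszPotential_rpow_le_of_supersolution (hαn : 0 < (n : ℝ) - 2 * α) (hq : 0 < q)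
    (hq1 : q < 1) {σ : Measure (Rn n)} [SigmaFinite σ] {u : Rn n → ℝ≥0∞}
    (hu : AEMeasurable u σ)
    (hsup : ∀ᵐ x ∂σ, rieszPotential α (σ.withDensity fun y => u y ^ q) x ≤ u x)
    (hnt : IsNontrivial σ u) (x : Rn n) :
    rieszPotential α σ x ^ (1 / (1 - q)) ≤
      (2 ^ ((1 + ((n : ℝ) - 2 * α)) / (1 - q))) ^ (1 / (1 - q)) *
        rieszPotential α (σ.withDensity fun y => u y ^ q) x := by
  have hq1' : 0 < 1 - q := by linarith
  obtain ⟨k₀, hk₀⟩ := exists_measure_ball_pos (withDensity_ne_zero_of_isNontrivial hq hu hnt)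
  refine le_of_tendsto (((ENNReal.continuous_rpow_const).tendsto _).comp
    (tendsto_rieszPotential_restrict_ball σ x)) ?_
  filter_upwards [eventually_ge_atTop k₀] with k hk
  have hR : 0 < σ.withDensity (fun y => u y ^ q) (Metric.ball 0 (k : ℝ)) :=
    hk₀.trans_le (measure_mono (Metric.ball_subset_ball (by exact_mod_cast hk)))
  have h := rieszPotential_restrict_rpow_le hαn hq hq1 hu hsup hR x
  have hC0 : (2 : ℝ≥0∞) ^ ((1 + ((n : ℝ) - 2 * α)) / (1 - q)) ≠ 0 :=
    (ENNReal.rpow_pos (by norm_num) (by simp)).ne'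
  have hCt : (2 : ℝ≥0∞) ^ ((1 + ((n : ℝ) - 2 * α)) / (1 - q)) ≠ ∞ :=
    ENNReal.rpow_ne_top_of_nonneg (by positivity) (by simp)
  rw [ENNReal.mul_rpow_of_nonneg _ _ (by positivity), ENNReal.inv_rpow,
    ENNReal.inv_mul_le_iff] at h
  · exact h
  · exact (ENNReal.rpow_pos (pos_iff_ne_zero.2 hC0) hCt).ne'
  · exact ENNReal.rpow_ne_top_of_nonneg (by positivity) hCt

end LowerBound

/-! ### Weak type estimate and Kolmogorov's inequality -/

section WeakType

variable {n : ℕ} {α q : ℝ}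

/-- If the potential of `ν` exceeds that of `ω` at `x`, then some ball around `x` has large `ν`
measure compared to the `ω` measure of its enlargement. -/
theorem exists_ball_of_rieszPotential_lt (hαn : 0 < (n : ℝ) - 2 * α) {ω ν : Measure (Rn n)}
    [SFinite ω] [SFinite ν] {t : ℝ≥0∞} (ht : t ≠ ∞) {x : Rn n}
    (hx : t * rieszPotential α ω x < rieszPotential α ν x) :
    ∃ r : ℝ, 0 < r ∧ t * ω (Metric.closedBall x (5 * r)) ≤
      ENNReal.ofReal (6 ^ ((n : ℝ) - 2 * α)) * ν (Metric.closedBall x r) := by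
  -- If every radius failed, then 6^β ν(B(x,r)) ≤ t ω(B(x,6r)) for all r > 0. Integration in r
  -- produces the same factor 6^β on the right, contradicting the hypothesis. The 5 is the Vitali
  -- enlargement; 6 leaves room to pass from closed to open balls.
  by_contra! h
  set β := (n : ℝ) - 2 * α
  have hc0 : ENNReal.ofReal ((6 : ℝ) ^ β) ≠ 0 := by
    simpa using Real.rpow_pos_of_pos (by norm_num : (0 : ℝ) < 6) β
  have hle : ENNReal.ofReal (6 ^ β) * rieszPotential α ν x ≤
      ENNReal.ofReal (6 ^ β) * (t * rieszPotential α ω x) := by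
    rw [rieszPotential_eq_tailIntegral hαn ν, rieszPotential_eq_tailIntegral hαn ω]
    calc ENNReal.ofReal (6 ^ β) * (ENNReal.ofReal β *
          tailIntegral β (fun r => ν (Metric.ball x r)) 0)
        = ENNReal.ofReal β *
          tailIntegral β (fun r => ENNReal.ofReal (6 ^ β) * ν (Metric.ball x r)) 0 := by
          rw [tailIntegral_const_mul _ ENNReal.ofReal_ne_top]; ring
      _ ≤ ENNReal.ofReal β * tailIntegral β (fun r => t * ω (Metric.ball x (6 * r))) 0 := by
          gcongr
          refine tailIntegral_mono fun r hr => ?_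
          calc _ ≤ ENNReal.ofReal (6 ^ β) * ν (Metric.closedBall x r) := by
                gcongr; exact Metric.ball_subset_closedBall
            _ ≤ t * ω (Metric.closedBall x (5 * r)) := (h r hr).le
            _ ≤ _ := by gcongr; exact Metric.closedBall_subset_ball (by linarith)
      _ = _ := by
          rw [tailIntegral_const_mul _ ht, tailIntegral_comp_mul (g := fun r => ω (Metric.ball x r))
            (by norm_num : (0 : ℝ) < 6) le_rfl, mul_zero]
          ring
  rw [ENNReal.mul_le_mul_iff_right hc0 ENNReal.ofReal_ne_top] at hle
  exact absurd hx (not_lt.2 hle)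

/-- Weak type estimate for the quotient of two Riesz potentials. -/
theorem mul_measure_le_of_rieszPotential_lt (hαn : 0 < (n : ℝ) - 2 * α) {ω ν : Measure (Rn n)}
    [SFinite ω] [SFinite ν] {t : ℝ≥0∞} (ht : t ≠ ∞) {S : Set (Rn n)}
    (hSb : Bornology.IsBounded S)
    (hS : ∀ x ∈ S, t * rieszPotential α ω x < rieszPotential α ν x) :
    t * ω S ≤ ENNReal.ofReal (6 ^ ((n : ℝ) - 2 * α)) * ν univ := by
  set D : ℝ≥0∞ := ENNReal.ofReal (6 ^ ((n : ℝ) - 2 * α))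
  choose! r hr0 hr using fun x hx => exists_ball_of_rieszPotential_lt hαn ht (hS x hx)
  obtain ⟨R, hR⟩ := hSb.subset_closedBall 0
  -- The covering lemma needs bounded radii. A ball of radius at least 2R has an enlargement that
  -- already covers S.
  by_cases hbig : ∃ x ∈ S, 2 * R ≤ r x
  · obtain ⟨x, hx, hxR⟩ := hbig
    have hsub : S ⊆ Metric.closedBall x (5 * r x) := fun y hy => by
      have h1 := Metric.mem_closedBall.1 (hR hx)
      have h2 := Metric.mem_closedBall.1 (hR hy)
      rw [Metric.mem_closedBall]
      linarith [dist_triangle_right y x 0, hr0 x hx]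
    calc t * ω S ≤ t * ω (Metric.closedBall x (5 * r x)) := by gcongr
      _ ≤ D * ν (Metric.closedBall x (r x)) := hr x hx
      _ ≤ D * ν univ := by gcongr; exact subset_univ _
  · push Not at hbig
    obtain ⟨u, huS, hdisj, hcov⟩ := Vitali.exists_disjoint_subfamily_covering_enlargement_closedBall
      S id r (2 * R) (fun a ha => (hbig a ha).le) 5 (by norm_num)
    simp only [id] at hdisj hcov
    have hcount : u.Countable := hdisj.countable_of_nonempty_interior fun i hi =>
      ⟨i, by
        rw [mem_interior_iff_mem_nhds]
        exact Metric.closedBall_mem_nhds i (hr0 i (huS hi))⟩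
    have hsub : S ⊆ ⋃ b ∈ u, Metric.closedBall b (5 * r b) := fun a ha => by
      obtain ⟨b, hb, hab⟩ := hcov a ha
      exact mem_biUnion hb (hab (Metric.mem_closedBall_self (hr0 a ha).le))
    calc t * ω S ≤ t * ∑' b : u, ω (Metric.closedBall (b : Rn n) (5 * r b)) := by
          gcongr
          exact (measure_mono hsub).trans (measure_biUnion_le ω hcount _)
      _ = ∑' b : u, t * ω (Metric.closedBall (b : Rn n) (5 * r b)) := ENNReal.tsum_mul_left.symm
      _ ≤ ∑' b : u, D * ν (Metric.closedBall (b : Rn n) (r b)) :=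
          ENNReal.tsum_le_tsum fun b => hr b (huS b.2)
      _ = D * ∑' b : u, ν (Metric.closedBall (b : Rn n) (r b)) := ENNReal.tsum_mul_left
      _ = D * ν (⋃ b ∈ u, Metric.closedBall b (r b)) := by
          rw [measure_biUnion hcount hdisj fun _ _ => Metric.isClosed_closedBall.measurableSet]
      _ ≤ D * ν univ := by gcongr; exact subset_univ _

/-- Kolmogorov's inequality: weak type `(1,1)` bounds imply `L^q` bounds, `0 < q < 1`. -/
theorem lintegral_rpow_le_of_weakType {X : Type*} [MeasurableSpace X] {ω : Measure X}
    [IsFiniteMeasure ω] (hq : 0 < q) (hq1 : q < 1) {f : X → ℝ≥0∞} (hf : AEMeasurable f ω)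
    {A : ℝ≥0∞} (hA : A ≠ ∞)
    (hw : ∀ t : ℝ, 0 < t → ENNReal.ofReal t * ω {x | ENNReal.ofReal t < f x} ≤ A) :
    ∫⁻ x, f x ^ q ∂ω ≤ ENNReal.ofReal (1 / (1 - q)) * (ω univ ^ (1 - q) * A ^ q) := by
  have hq1' : 0 < 1 - q := by linarith
  rcases eq_or_ne (ω univ) 0 with h0 | h0
  · rw [Measure.measure_univ_eq_zero.1 h0, lintegral_zero_measure]; exact zero_le
  set m := (ω univ).toReal with hm
  have hm0 : 0 < m := ENNReal.toReal_pos h0 (measure_ne_top _ _)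
  have hωm : ω univ = ENNReal.ofReal m := (ENNReal.ofReal_toReal (measure_ne_top _ _)).symm
  -- it suffices to treat positive bounds
  suffices H : ∀ a : ℝ, 0 < a → A ≤ ENNReal.ofReal a →
      ∫⁻ x, f x ^ q ∂ω ≤ ENNReal.ofReal (1 / (1 - q)) * (ω univ ^ (1 - q) * ENNReal.ofReal a ^ q) by
    have hlim : Tendsto (fun k : ℕ => ENNReal.ofReal (1 / (1 - q)) *
        (ω univ ^ (1 - q) * ENNReal.ofReal (A.toReal + 1 / ((k : ℝ) + 1)) ^ q)) atTop
        (nhds (ENNReal.ofReal (1 / (1 - q)) * (ω univ ^ (1 - q) * A ^ q))) := by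
      refine ENNReal.Tendsto.const_mul (ENNReal.Tendsto.const_mul ?_
        (Or.inr (ENNReal.rpow_ne_top_of_nonneg hq1'.le (measure_ne_top _ _))))
        (Or.inr ENNReal.ofReal_ne_top)
      refine ((ENNReal.continuous_rpow_const).tendsto _).comp ?_
      have h1 : Tendsto (fun k : ℕ => A.toReal + 1 / ((k : ℝ) + 1)) atTop (nhds (A.toReal + 0)) :=
        tendsto_const_nhds.add tendsto_one_div_add_atTop_nhds_zero_nat
      rw [add_zero] at h1
      simpa only [Function.comp_def, ENNReal.ofReal_toReal hA] using
        (ENNReal.continuous_ofReal.tendsto A.toReal).comp h1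
    refine ge_of_tendsto' hlim fun k => H _ (by positivity) ?_
    calc A = ENNReal.ofReal A.toReal := (ENNReal.ofReal_toReal hA).symm
      _ ≤ _ := ENNReal.ofReal_le_ofReal (by
        have : (0 : ℝ) < 1 / ((k : ℝ) + 1) := by positivity
        linarith)
  intro a ha hAa
  -- If f were infinite on a set of mass p > 0, the weak bound would fail at t = 2a/p.
  have hfin : ∀ᵐ x ∂ω, f x ≠ ∞ := by
    rw [ae_iff]
    simp only [not_not]
    by_contra hpos
    have hpos' : ω {x | f x = ∞} ≠ 0 := hpos
    obtain ⟨t, ht0, ht⟩ : ∃ t : ℝ, 0 < t ∧ ENNReal.ofReal a < ENNReal.ofReal t * ω {x | f x = ∞} := by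
      set p := (ω {x | f x = ∞}).toReal
      have hp0 : 0 < p := ENNReal.toReal_pos hpos' (measure_ne_top _ _)
      refine ⟨2 * a / p, by positivity, ?_⟩
      rw [show ω {x | f x = ∞} = ENNReal.ofReal p from
        (ENNReal.ofReal_toReal (measure_ne_top _ _)).symm, ← ENNReal.ofReal_mul (by positivity),
        div_mul_cancel₀ _ hp0.ne']
      exact (ENNReal.ofReal_lt_ofReal_iff (by positivity)).2 (by linarith)
    refine absurd ((ht.trans_le ?_).trans_le ((hw t ht0).trans hAa)) (lt_irrefl _)
    gcongr with x
    intro hx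
    rw [hx]; exact ENNReal.ofReal_lt_top
  have hconv : ∫⁻ x, f x ^ q ∂ω = ∫⁻ x, ENNReal.ofReal ((f x).toReal ^ q) ∂ω := by
    refine lintegral_congr_ae (hfin.mono fun x hx => ?_)
    show f x ^ q = ENNReal.ofReal ((f x).toReal ^ q)
    rw [← ENNReal.ofReal_rpow_of_nonneg ENNReal.toReal_nonneg hq.le, ENNReal.ofReal_toReal hx]
  rw [hconv, lintegral_rpow_eq_lintegral_meas_lt_mul ω (ae_of_all _ fun _ => ENNReal.toReal_nonneg)
    hf.ennreal_toReal hq]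
  have hset : ∀ t : ℝ, 0 < t → ω {x | t < (f x).toReal} ≤ ω {x | ENNReal.ofReal t < f x} :=
    fun t ht => measure_mono fun x hx => by
      have hx' : t < (f x).toReal := hx
      show ENNReal.ofReal t < f x
      by_cases hxt : f x = ∞
      · rw [hxt]; exact ENNReal.ofReal_lt_top
      · exact (ENNReal.ofReal_lt_iff_lt_toReal ht.le hxt).2 hx'
  -- The height at which the trivial bound m and the weak type bound a/t for the distribution
  -- function coincide.
  set T := a / m with hT
  have hT0 : 0 < T := by positivity
  have hI1 : ∫⁻ t in Ioc 0 T, ω {x | t < (f x).toReal} * ENNReal.ofReal (t ^ (q - 1)) ≤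
      ENNReal.ofReal (m * (T ^ q / q)) := by
    calc _ ≤ ∫⁻ t in Ioc 0 T, ENNReal.ofReal m * ENNReal.ofReal (t ^ (q - 1)) := by
          refine setLIntegral_mono' measurableSet_Ioc fun t ht => ?_
          gcongr
          rw [← hωm]; exact measure_mono (subset_univ _)
      _ = ENNReal.ofReal m * ENNReal.ofReal (T ^ q / q) := by
          rw [lintegral_const_mul' _ _ ENNReal.ofReal_ne_top, ← ofReal_integral_eq_lintegral_ofReal]
          · rw [← intervalIntegral.integral_of_le hT0.le, integral_rpow (Or.inl (by linarith))]
            rw [sub_add_cancel, Real.zero_rpow hq.ne', sub_zero]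
          · exact (intervalIntegrable_iff_integrableOn_Ioc_of_le hT0.le).1
              (intervalIntegral.intervalIntegrable_rpow' (by linarith))
          · exact (ae_restrict_iff' measurableSet_Ioc).2 (ae_of_all _ fun t ht =>
              Real.rpow_nonneg ht.1.le _)
      _ = _ := (ENNReal.ofReal_mul hm0.le).symm
  have hI2 : ∫⁻ t in Ioi T, ω {x | t < (f x).toReal} * ENNReal.ofReal (t ^ (q - 1)) ≤
      ENNReal.ofReal (a * (T ^ (q - 1) / (1 - q))) := by
    calc _ ≤ ∫⁻ t in Ioi T, ENNReal.ofReal a * ENNReal.ofReal (t ^ (q - 2)) := by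
          refine setLIntegral_mono' measurableSet_Ioi fun t ht => ?_
          have ht0 : 0 < t := hT0.trans ht
          have h1 : ENNReal.ofReal (t ^ (q - 1)) = ENNReal.ofReal t * ENNReal.ofReal (t ^ (q - 2)) := by
            rw [← ENNReal.ofReal_mul ht0.le]
            congr 1
            rw [show q - 1 = 1 + (q - 2) by ring, Real.rpow_add ht0, Real.rpow_one]
          rw [h1, ← mul_assoc]
          gcongr
          rw [mul_comm]
          refine le_trans ?_ ((hw t ht0).trans hAa)
          exact mul_le_mul' le_rfl (hset t ht0)
      _ = ENNReal.ofReal a * ENNReal.ofReal (T ^ (q - 1) / (1 - q)) := by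
          rw [lintegral_const_mul' _ _ ENNReal.ofReal_ne_top, ← ofReal_integral_eq_lintegral_ofReal]
          · rw [integral_Ioi_rpow_of_lt (by linarith) hT0]
            congr 2
            rw [show q - 2 + 1 = q - 1 by ring, ← neg_sub 1 q, neg_div_neg_eq]
          · exact integrableOn_Ioi_rpow_of_lt (by linarith) hT0
          · exact (ae_restrict_iff' measurableSet_Ioi).2 (ae_of_all _ fun t ht =>
              Real.rpow_nonneg (hT0.trans ht).le _)
      _ = _ := (ENNReal.ofReal_mul ha.le).symm
  calc ENNReal.ofReal q * ∫⁻ t in Ioi 0, ω {x | t < (f x).toReal} * ENNReal.ofReal (t ^ (q - 1))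
      ≤ ENNReal.ofReal q * (ENNReal.ofReal (m * (T ^ q / q)) +
          ENNReal.ofReal (a * (T ^ (q - 1) / (1 - q)))) := by
        gcongr
        rw [← Ioc_union_Ioi_eq_Ioi hT0.le]
        exact (lintegral_union_le _ _ _).trans (add_le_add hI1 hI2)
    _ = ENNReal.ofReal (1 / (1 - q) * (m ^ (1 - q) * a ^ q)) := by
        rw [← ENNReal.ofReal_add (by positivity) (by positivity), ← ENNReal.ofReal_mul hq.le]
        congr 1
        have e1 : T ^ q = a ^ q / m ^ q := Real.div_rpow ha.le hm0.le q
        have e2 : T ^ (q - 1) = T ^ q / T := by rw [Real.rpow_sub hT0, Real.rpow_one]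
        have e3 : m ^ (1 - q) = m / m ^ q := by rw [Real.rpow_sub hm0, Real.rpow_one]
        rw [e2, e1, e3, hT]
        have := Real.rpow_pos_of_pos hm0 q
        field_simp
        ring
    _ = _ := by
        rw [ENNReal.ofReal_mul (by positivity), ENNReal.ofReal_mul (by positivity), hωm,
          ENNReal.ofReal_rpow_of_pos hm0, ENNReal.ofReal_rpow_of_pos ha]

end WeakType

/-! ### The constant κ and the lower bound by the intrinsic potential -/

section Kappa

variable {n : ℕ} {α q : ℝ}

theorem kappaConst_mono {σ : Measure (Rn n)} {A B : Set (Rn n)} (hq : 0 < q) (h : A ⊆ B) :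
    kappaConst α q σ A ≤ kappaConst α q σ B := by
  refine sInf_le_sInf fun C hC ν hν => le_trans ?_ (hC ν hν)
  exact ENNReal.rpow_le_rpow (lintegral_mono_set h) (by positivity)

theorem kappaConst_restrict {σ : Measure (Rn n)} {A B : Set (Rn n)} (hA : MeasurableSet A)
    (h : A ⊆ B) : kappaConst α q (σ.restrict B) A = kappaConst α q σ A := by
  unfold kappaConst
  rw [Measure.restrict_restrict hA, inter_eq_self_of_subset_left h]

/-- The inequality defining `κ` holds with the constant `κ`. -/
theorem lintegral_rieszPotential_rpow_le (hq : 0 < q) (σ : Measure (Rn n)) (B : Set (Rn n))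
    (ν : Measure (Rn n)) [IsFiniteMeasure ν] :
    ∫⁻ x in B, rieszPotential α ν x ^ q ∂σ ≤ kappaConst α q σ B ^ q * ν univ ^ q := by
  rcases eq_or_ne (ν univ) 0 with h0 | h0
  · rw [Measure.measure_univ_eq_zero.1 h0]
    simp [rieszPotential, hq]
  rw [← ENNReal.mul_rpow_of_nonneg _ _ hq.le, ← ENNReal.rpow_inv_le_iff hq, ← one_div,
    ← ENNReal.div_le_iff h0 (measure_ne_top _ _)]
  exact le_sInf fun C hC => (ENNReal.div_le_iff h0 (measure_ne_top _ _)).2 (hC ν inferInstance)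

/-- Test with ν = σ restricted to B: its potential is positive everywhere, so its q-integral over B
is positive. -/
theorem kappaConst_ne_zero (hαn : 0 < (n : ℝ) - 2 * α) (hq : 0 < q) {σ : Measure (Rn n)}
    {B : Set (Rn n)} (h0 : σ B ≠ 0) (ht : σ B ≠ ∞) : kappaConst α q σ B ≠ 0 := by
  intro hk
  have : IsFiniteMeasure (σ.restrict B) := ⟨by simpa using ht.lt_top⟩
  have hne : σ.restrict B ≠ 0 := by
    rwa [Ne, Measure.restrict_eq_zero]
  have h := lintegral_rieszPotential_rpow_le (α := α) hq σ B (σ.restrict B)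
  rw [hk, ENNReal.zero_rpow_of_pos hq, zero_mul, nonpos_iff_eq_zero,
    lintegral_eq_zero_iff ((measurable_rieszPotential _).pow_const q)] at h
  have hfalse : ∀ᵐ x ∂(σ.restrict B), False := h.mono fun x hx => by
    have h1 : rieszPotential α (σ.restrict B) x ^ q = 0 := hx
    rw [ENNReal.rpow_eq_zero_iff_of_pos hq] at h1
    exact absurd h1 (rieszPotential_pos hαn hne x).ne'
  rw [ae_iff] at hfalse
  simp only [not_false_eq_true, ofPred_true] at hfalse
  exact hne (Measure.measure_univ_eq_zero.1 hfalse)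

/-- The constant in the bound for `κ` by the mass of a supersolution. -/
noncomputable def kappaBoundConst (n : ℕ) (α q : ℝ) : ℝ≥0∞ :=
  (ENNReal.ofReal (1 / (1 - q)) * ENNReal.ofReal (6 ^ ((n : ℝ) - 2 * α)) ^ q) ^ (1 / (1 - q))

theorem kappaBoundConst_pos (hq1 : q < 1) : 0 < kappaBoundConst n α q := by
  have hq1' : 0 < 1 - q := by linarith
  have h6 : 0 < ENNReal.ofReal ((6 : ℝ) ^ ((n : ℝ) - 2 * α)) := by
    simpa using Real.rpow_pos_of_pos (by norm_num : (0 : ℝ) < 6) _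
  have h1 : 0 < ENNReal.ofReal (1 / (1 - q)) := by simpa using hq1
  have h2 := ENNReal.rpow_pos (p := q) h6 ENNReal.ofReal_ne_top
  refine ENNReal.rpow_pos_of_nonneg (ENNReal.mul_pos h1.ne' h2.ne') (by positivity)

theorem kappaBoundConst_ne_top (hq : 0 < q) (hq1 : q < 1) : kappaBoundConst n α q ≠ ∞ := by
  have hq1' : 0 < 1 - q := by linarith
  exact ENNReal.rpow_ne_top_of_nonneg (by positivity) (ENNReal.mul_ne_top ENNReal.ofReal_ne_top
    (ENNReal.rpow_ne_top_of_nonneg hq.le ENNReal.ofReal_ne_top))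

theorem ae_ne_zero_of_supersolution (hαn : 0 < (n : ℝ) - 2 * α) (hq : 0 < q)
    {σ : Measure (Rn n)} {u : Rn n → ℝ≥0∞} (hu : AEMeasurable u σ)
    (hsup : ∀ᵐ x ∂σ, rieszPotential α (σ.withDensity fun y => u y ^ q) x ≤ u x)
    (hnt : IsNontrivial σ u) : ∀ᵐ x ∂σ, u x ≠ 0 :=
  hsup.mono fun x hx => ((rieszPotential_pos hαn
    (withDensity_ne_zero_of_isNontrivial hq hu hnt) x).trans_le hx).ne'

/-- The mass of a supersolution over a bounded set controls `κ`. -/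
theorem kappaConst_rpow_le (hαn : 0 < (n : ℝ) - 2 * α) (hq : 0 < q) (hq1 : q < 1)
    {σ : Measure (Rn n)} [SigmaFinite σ] {u : Rn n → ℝ≥0∞} (hu : AEMeasurable u σ)
    (hsup : ∀ᵐ x ∂σ, rieszPotential α (σ.withDensity fun y => u y ^ q) x ≤ u x)
    (hnt : IsNontrivial σ u) {B : Set (Rn n)} (hB : MeasurableSet B)
    (hBb : Bornology.IsBounded B) :
    kappaConst α q σ B ^ (q / (1 - q)) ≤
      kappaBoundConst n α q * σ.withDensity (fun y => u y ^ q) B := by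
  have hq1' : 0 < 1 - q := by linarith
  set ω := σ.withDensity (fun y => u y ^ q) with hω
  have huq : AEMeasurable (fun y => u y ^ q) σ := hu.pow_const q
  rcases eq_or_ne (ω B) ∞ with htop | htop
  · rw [htop, ENNReal.mul_top (kappaBoundConst_pos hq1).ne']; exact le_top
  set D : ℝ≥0∞ := ENNReal.ofReal (6 ^ ((n : ℝ) - 2 * α)) with hD
  have hD0 : D ≠ 0 := by
    simpa [hD] using Real.rpow_pos_of_pos (by norm_num : (0 : ℝ) < 6) _
  set c : ℝ≥0∞ := ENNReal.ofReal (1 / (1 - q)) with hc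
  have hc0 : c ≠ 0 := by simpa [hc] using hq1
  set F : ℝ≥0∞ := c * D ^ q * ω B ^ (1 - q) with hF
  have hFt : F ≠ ∞ := ENNReal.mul_ne_top (ENNReal.mul_ne_top ENNReal.ofReal_ne_top
    (ENNReal.rpow_ne_top_of_nonneg hq.le ENNReal.ofReal_ne_top))
    (ENNReal.rpow_ne_top_of_nonneg hq1'.le htop)
  have hpos : ∀ᵐ x ∂σ, u x ≠ 0 := ae_ne_zero_of_supersolution hαn hq hu hsup hnt
  have hωB : ω B = ∫⁻ x in B, u x ^ q ∂σ := withDensity_apply _ hB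
  -- F is the Kolmogorov bound for Iν/u on B with respect to ω, without the factor ν(ℝⁿ)^q.
  have hκ : kappaConst α q σ B ≤ F ^ (1 / q) := by
    refine sInf_le fun ν hν => ?_
    rcases eq_or_ne (ω B) 0 with h0 | h0
    · have hB0 : σ B = 0 := by
        rw [hωB, lintegral_eq_zero_iff' huq.restrict] at h0
        have hfalse : ∀ᵐ x ∂(σ.restrict B), False := by
          filter_upwards [h0, ae_restrict_of_ae hpos] with x h1 h2
          have h1' : u x ^ q = 0 := h1
          exact h2 ((ENNReal.rpow_eq_zero_iff_of_pos hq).1 h1')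
        rw [ae_iff] at hfalse
        simpa using hfalse
      rw [setLIntegral_measure_zero _ _ hB0, ENNReal.zero_rpow_of_pos (by positivity)]
      exact zero_le
    have hF0 : F ≠ 0 := by
      refine mul_ne_zero (mul_ne_zero hc0 ?_) ?_
      · exact (ENNReal.rpow_pos (pos_iff_ne_zero.2 hD0) ENNReal.ofReal_ne_top).ne'
      · exact (ENNReal.rpow_pos (pos_iff_ne_zero.2 h0) htop).ne'
    rcases eq_or_ne (ν univ) ∞ with hνt | hνt
    · rw [hνt, ENNReal.mul_top (ENNReal.rpow_pos (pos_iff_ne_zero.2 hF0) hFt).ne']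
      exact le_top
    have : IsFiniteMeasure ν := ⟨hνt.lt_top⟩
    have : IsFiniteMeasure (ω.restrict B) := ⟨by simpa using htop.lt_top⟩
    have hfin : ∀ᵐ x ∂(σ.restrict B), u x ≠ ∞ := by
      rw [hωB] at htop
      filter_upwards [ae_lt_top' huq.restrict htop] with x hx hxt
      rw [hxt, ENNReal.top_rpow_of_pos hq] at hx
      exact lt_irrefl _ hx
    -- Dividing by u trades dσ for dω. As u ≥ Iω σ-a.e., the superlevel sets of f lie, up to null
    -- sets, in those of Iν/Iω, where the weak type estimate applies.
    set f : Rn n → ℝ≥0∞ := fun x => rieszPotential α ν x / u x with hf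
    have hfm : AEMeasurable f σ := (measurable_rieszPotential ν).aemeasurable.div hu
    have hac : ω.restrict B ≪ σ.restrict B := (withDensity_absolutelyContinuous _ _).restrict B
    have hint : ∫⁻ x in B, rieszPotential α ν x ^ q ∂σ = ∫⁻ x, f x ^ q ∂(ω.restrict B) := by
      rw [setLIntegral_withDensity_eq_lintegral_mul₀ huq (hfm.pow_const q) hB]
      refine lintegral_congr_ae ?_
      filter_upwards [hfin, ae_restrict_of_ae hpos] with x h1 h2
      simp only [Pi.mul_apply, hf]
      rw [← ENNReal.mul_rpow_of_nonneg _ _ hq.le, ENNReal.mul_div_cancel h2 h1]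
    have hweak : ∀ t : ℝ, 0 < t →
        ENNReal.ofReal t * (ω.restrict B) {x | ENNReal.ofReal t < f x} ≤ D * ν univ := by
      intro t _
      set S : Set (Rn n) :=
        {x ∈ B | ENNReal.ofReal t * rieszPotential α ω x < rieszPotential α ν x}
      have hS : (ω.restrict B) {x | ENNReal.ofReal t < f x} ≤ ω S := by
        refine (measure_mono_ae (hac.ae_le ?_)).trans (Measure.restrict_apply_le B S)
        filter_upwards [hfin, ae_restrict_of_ae hpos, ae_restrict_of_ae hsup,
          ae_restrict_mem hB] with x h1 h2 h3 h4 h5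
        have h5' : ENNReal.ofReal t < rieszPotential α ν x / u x := h5
        rw [ENNReal.lt_div_iff_mul_lt (Or.inl h2) (Or.inl h1)] at h5'
        exact ⟨h4, lt_of_le_of_lt (by gcongr) h5'⟩
      refine le_trans (mul_le_mul' le_rfl hS) ?_
      exact mul_measure_le_of_rieszPotential_lt hαn ENNReal.ofReal_ne_top
        (hBb.subset fun x hx => hx.1) fun x hx => hx.2
    have hkol := lintegral_rpow_le_of_weakType hq hq1 (hfm.mono_ac
      (withDensity_absolutelyContinuous _ _)).restrict
      (ENNReal.mul_ne_top ENNReal.ofReal_ne_top hνt) hweak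
    rw [hint, one_div, ENNReal.rpow_inv_le_iff hq, ENNReal.mul_rpow_of_nonneg _ _ hq.le,
      ENNReal.rpow_inv_rpow hq.ne']
    refine hkol.trans (le_of_eq ?_)
    rw [Measure.restrict_apply_univ, ENNReal.mul_rpow_of_nonneg _ _ hq.le, hF]
    ring
  -- F contains ω(B)^{1-q}, so the exponent 1/(1-q) makes the bound linear in ω(B).
  calc kappaConst α q σ B ^ (q / (1 - q)) ≤ (F ^ (1 / q)) ^ (q / (1 - q)) :=
        ENNReal.rpow_le_rpow hκ (by positivity)
    _ = F ^ (1 / (1 - q)) := by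
        rw [← ENNReal.rpow_mul]; congr 1; field_simp
    _ = _ := by
        rw [hF, ENNReal.mul_rpow_of_nonneg _ _ (by positivity), ← ENNReal.rpow_mul,
          mul_one_div_cancel hq1'.ne', ENNReal.rpow_one]
        rfl

/-- The constant in the lower bound for supersolutions. -/
noncomputable def lowerBoundConst (n : ℕ) (α q : ℝ) : ℝ≥0∞ :=
  kappaBoundConst n α q * (ENNReal.ofReal ((n : ℝ) - 2 * α))⁻¹ +
    (2 ^ ((1 + ((n : ℝ) - 2 * α)) / (1 - q))) ^ (1 / (1 - q))

theorem lowerBoundConst_ne_top (hαn : 0 < (n : ℝ) - 2 * α) (hq : 0 < q) (hq1 : q < 1) :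
    lowerBoundConst n α q ≠ ∞ := by
  have hq1' : 0 < 1 - q := by linarith
  refine ENNReal.add_ne_top.2 ⟨ENNReal.mul_ne_top (kappaBoundConst_ne_top hq hq1) ?_, ?_⟩
  · simpa using hαn
  · exact ENNReal.rpow_ne_top_of_nonneg (by positivity)
      (ENNReal.rpow_ne_top_of_nonneg (by positivity) (by simp))

/-- Nontrivial supersolutions dominate `K_{α,2} σ + (I_{2α} σ)^{1/(1-q)}`. -/
theorem boundFunction_le_of_supersolution (hαn : 0 < (n : ℝ) - 2 * α) (hq : 0 < q) (hq1 : q < 1)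
    {σ : Measure (Rn n)} [SigmaFinite σ] {u : Rn n → ℝ≥0∞} (hu : AEMeasurable u σ)
    (hsup : ∀ᵐ x ∂σ, rieszPotential α (σ.withDensity fun y => u y ^ q) x ≤ u x)
    (hnt : IsNontrivial σ u) (x : Rn n) :
    boundFunction α q σ x ≤
      lowerBoundConst n α q * rieszPotential α (σ.withDensity fun y => u y ^ q) x := by
  unfold boundFunction lowerBoundConst
  rw [add_mul]
  refine add_le_add ?_ (rieszPotential_rpow_le_of_supersolution hαn hq hq1 hu hsup hnt x)
  rw [rieszPotential_eq_tailIntegral hαn, mul_assoc, ← mul_assoc (ENNReal.ofReal _)⁻¹,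
    ENNReal.inv_mul_cancel (by simpa using hαn) ENNReal.ofReal_ne_top, one_mul,
    ← tailIntegral_const_mul _ (kappaBoundConst_ne_top hq hq1)]
  exact tailIntegral_mono fun r _ => kappaConst_rpow_le hαn hq hq1 hu hsup hnt
    Metric.isOpen_ball.measurableSet Metric.isBounded_ball

end Kappa

/-! ### Supersolutions on sets with finite κ -/

section LocalSupersolution

variable {n : ℕ} {α q : ℝ}

theorem ENNReal.iSup_rpow_of_pos {ι : Sort*} (hq : 0 < q) (f : ι → ℝ≥0∞) :
    (⨆ i, f i) ^ q = ⨆ i, f i ^ q :=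
  (ENNReal.orderIsoRpow q hq).map_iSup f

theorem rieszPotential_iSup (hq : 0 < q) {σ : Measure (Rn n)} {u : ℕ → Rn n → ℝ≥0∞}
    (hu : ∀ k, Measurable (u k)) (hmono : Monotone u) (x : Rn n) :
    rieszPotential α (σ.withDensity fun y => (⨆ k, u k y) ^ q) x
      = ⨆ k, rieszPotential α (σ.withDensity fun y => u k y ^ q) x := by
  have h1 : ∀ k, rieszPotential α (σ.withDensity fun y => u k y ^ q) x
      = ∫⁻ y, edist x y ^ (2 * α - (n : ℝ)) * u k y ^ q ∂σ := fun k =>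
    rieszPotential_withDensity ((hu k).pow_const q).aemeasurable x
  rw [rieszPotential_withDensity ((Measurable.iSup hu).pow_const q).aemeasurable]
  simp only [h1, ENNReal.iSup_rpow_of_pos hq, ENNReal.mul_iSup]
  refine lintegral_iSup (fun k => ?_) fun i j hij y => ?_
  · exact Measurable.mul (by fun_prop) ((hu k).pow_const q)
  · have := hmono hij y
    dsimp only
    gcongr

theorem rieszPotential_withDensity_mono (hq : 0 ≤ q) {σ : Measure (Rn n)} {u v : Rn n → ℝ≥0∞}
    (h : ∀ᵐ y ∂σ, u y ≤ v y) (x : Rn n) :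
    rieszPotential α (σ.withDensity fun y => u y ^ q) x
      ≤ rieszPotential α (σ.withDensity fun y => v y ^ q) x :=
  rieszPotential_mono (withDensity_mono (h.mono fun _ hy => ENNReal.rpow_le_rpow hy hq)) x

/-- A set of finite measure with finite `κ` carries a positive supersolution whose mass is
controlled by `κ`. -/
theorem exists_supersolution_restrict (hαn : 0 < (n : ℝ) - 2 * α) (hq : 0 < q) (hq1 : q < 1)
    {σ : Measure (Rn n)} [SigmaFinite σ] {B : Set (Rn n)} (hB0 : σ B ≠ 0) (hBt : σ B ≠ ∞)
    (hκ : kappaConst α q σ B ≠ ∞) :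
    ∃ u : Rn n → ℝ≥0∞, Measurable u ∧ (∀ x, u x ≠ 0) ∧
      (∀ x, rieszPotential α ((σ.restrict B).withDensity fun y => u y ^ q) x ≤ u x) ∧
      ∫⁻ x in B, u x ^ q ∂σ ≤ 2 ^ (1 / (1 - q)) * kappaConst α q σ B ^ (q / (1 - q)) := by
  have hq1' : 0 < 1 - q := by linarith
  set κ := kappaConst α q σ B with hκdef
  have hκ0 : κ ≠ 0 := kappaConst_ne_zero hαn hq hB0 hBt
  set K : ℝ≥0∞ := κ ^ (q / (1 - q)) with hK
  have hK0 : K ≠ 0 := (ENNReal.rpow_pos (pos_iff_ne_zero.2 hκ0) hκ).ne'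
  have hKt : K ≠ ∞ := ENNReal.rpow_ne_top_of_nonneg (by positivity) hκ
  set M : ℝ≥0∞ := 2 ^ (1 / (1 - q)) with hM
  have hMt : M ≠ ∞ := ENNReal.rpow_ne_top_of_nonneg (by positivity) (by simp)
  have hM1 : 1 ≤ M := ENNReal.one_le_rpow (by norm_num) (by positivity)
  -- M is the root of 2 M^q = M, and M ≥ 1. With κ^q K^q = K below, this makes the mass bound M K
  -- stable under the iteration.
  have hMq : M ^ q + 1 ≤ M := by
    calc M ^ q + 1 ≤ M ^ q + M ^ q := by gcongr; exact ENNReal.one_le_rpow hM1 hq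
      _ = 2 ^ (1 : ℝ) * 2 ^ (1 / (1 - q) * q) := by
          rw [← two_mul, hM, ENNReal.rpow_mul, ENNReal.rpow_one]
      _ = M := by
          rw [← ENNReal.rpow_add _ _ (by simp) (by simp), hM]
          congr 1; field_simp; ring
  have hKM : κ ^ q * K ^ q = K := by
    rw [hK, ← ENNReal.rpow_mul, ← ENNReal.rpow_add _ _ hκ0 hκ]
    congr 1; field_simp; ring
  -- Chosen so that the constant ε has q-mass exactly K on B. Adding ε at each step also keeps the
  -- iterates positive.
  set ε : ℝ≥0∞ := (K / σ B) ^ (1 / q) with hε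
  have hε0 : ε ≠ 0 := (ENNReal.rpow_pos (ENNReal.div_pos hK0 hBt)
    (ENNReal.div_ne_top hKt hB0)).ne'
  have hεq : ε ^ q * σ B = K := by
    rw [hε, one_div, ENNReal.rpow_inv_rpow hq.ne', ENNReal.div_mul_cancel hB0 hBt]
  set σ' := σ.restrict B
  let T : (Rn n → ℝ≥0∞) → Rn n → ℝ≥0∞ := fun w x =>
    rieszPotential α (σ'.withDensity fun y => w y ^ q) x + ε
  have hTm : ∀ w, Measurable (T w) := fun w => (measurable_rieszPotential _).add_const ε
  have hTmono : Monotone T := fun w₁ w₂ h x => by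
    show _ + _ ≤ _ + _
    gcongr
    exact rieszPotential_withDensity_mono hq.le (ae_of_all _ h) x
  let u : ℕ → Rn n → ℝ≥0∞ := fun k => T^[k] fun _ => ε
  have husucc : ∀ k, u (k + 1) = T (u k) := fun k => Function.iterate_succ_apply' T k _
  have humono : Monotone u := hTmono.monotone_iterate_of_le_map fun x => le_add_self
  have hum : ∀ k, Measurable (u k) := fun k => by
    cases k with
    | zero => exact measurable_const
    | succ k => rw [husucc]; exact hTm _
  have hX : ∀ k, ∫⁻ x, u k x ^ q ∂σ' ≤ M * K := by
    intro k
    induction k with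
    | zero =>
      have h0 : ∫⁻ x, u 0 x ^ q ∂σ' = K := by
        show ∫⁻ x, ε ^ q ∂σ' = K
        rw [lintegral_const, Measure.restrict_apply_univ, hεq]
      rw [h0]
      exact le_mul_of_one_le_left' hM1
    | succ k ih =>
      set ν := σ'.withDensity fun y => u k y ^ q with hν
      have hνu : ν univ = ∫⁻ x, u k x ^ q ∂σ' := by
        rw [hν, withDensity_apply _ MeasurableSet.univ, Measure.restrict_univ]
      have : IsFiniteMeasure ν := ⟨by
        rw [hνu]; exact ih.trans_lt (ENNReal.mul_lt_top hMt.lt_top hKt.lt_top)⟩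
      calc ∫⁻ x, u (k + 1) x ^ q ∂σ'
          ≤ ∫⁻ x, (rieszPotential α ν x ^ q + ε ^ q) ∂σ' := by
            rw [husucc]
            exact lintegral_mono fun x => ENNReal.rpow_add_le_add_rpow _ _ hq.le hq1.le
        _ = ∫⁻ x, rieszPotential α ν x ^ q ∂σ' + K := by
            rw [lintegral_add_right _ measurable_const, lintegral_const,
              Measure.restrict_apply_univ, hεq]
        _ ≤ κ ^ q * (M * K) ^ q + K := by
            gcongr
            refine (lintegral_rieszPotential_rpow_le hq σ B ν).trans ?_
            rw [hνu]
            gcongr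
        _ = (M ^ q + 1) * K := by
            rw [ENNReal.mul_rpow_of_nonneg _ _ hq.le, add_mul, one_mul]
            congr 1
            calc κ ^ q * (M ^ q * K ^ q) = M ^ q * (κ ^ q * K ^ q) := by ring
              _ = _ := by rw [hKM]
        _ ≤ M * K := by gcongr
  refine ⟨fun x => ⨆ k, u k x, Measurable.iSup hum, fun x => ?_, fun x => ?_, ?_⟩
  · exact ((pos_iff_ne_zero.2 hε0).trans_le (le_iSup (fun k => u k x) 0)).ne'
  · rw [rieszPotential_iSup hq hum humono]
    refine iSup_le fun k => le_trans ?_ (le_iSup (fun k => u k x) (k + 1))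
    rw [husucc]
    exact le_self_add
  · simp_rw [ENNReal.iSup_rpow_of_pos hq]
    rw [lintegral_iSup (fun k => (hum k).pow_const q)
      fun i j hij x => ENNReal.rpow_le_rpow (humono hij x) hq.le]
    exact iSup_le hX

end LocalSupersolution

/-! ### The bound function is a supersolution up to a constant -/

section UpperBound

variable {n : ℕ} {α q : ℝ}

theorem intrinsicPotential_eq_tailIntegral (σ : Measure (Rn n)) (x : Rn n) :
    intrinsicPotential α q σ x = tailIntegral ((n : ℝ) - 2 * α)
      (fun r => kappaConst α q σ (Metric.ball x r) ^ (q / (1 - q))) 0 := rfl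

theorem monotone_kappaConst_ball (hq : 0 < q) (hq1 : q < 1) (σ : Measure (Rn n)) (x : Rn n) :
    Monotone fun r => kappaConst α q σ (Metric.ball x r) ^ (q / (1 - q)) := fun _ _ h =>
  ENNReal.rpow_le_rpow (kappaConst_mono hq (Metric.ball_subset_ball h))
    (div_nonneg hq.le (by linarith))

theorem monotone_measure_ball (σ : Measure (Rn n)) (x : Rn n) :
    Monotone fun r => σ (Metric.ball x r) := fun _ _ h =>
  measure_mono (Metric.ball_subset_ball h)

/-- The tail of `K_{α,2} σ + (I_{2α} σ)^{1/(1-q)}` at `x`, beyond the radius `r`. -/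
noncomputable def boundTail (α q : ℝ) (σ : Measure (Rn n)) (x : Rn n) (r : ℝ) : ℝ≥0∞ :=
  tailIntegral ((n : ℝ) - 2 * α) (fun s => kappaConst α q σ (Metric.ball x s) ^ (q / (1 - q))) r +
    tailIntegral ((n : ℝ) - 2 * α) (fun s => σ (Metric.ball x s)) r ^ (1 / (1 - q))

/-- On a ball, the bound function splits into its local part and the tail at the center. -/
theorem boundFunction_le_restrict_add_tail (hαn : 0 < (n : ℝ) - 2 * α) (hq : 0 < q)
    (hq1 : q < 1) :
    ∃ A : ℝ≥0∞, A ≠ 0 ∧ A ≠ ∞ ∧ ∀ (σ : Measure (Rn n)) [SigmaFinite σ] (x y : Rn n) (r : ℝ),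
      y ∈ Metric.ball x r → boundFunction α q σ y ≤
        A * (boundFunction α q (σ.restrict (Metric.ball x (2 * r))) y + boundTail α q σ x r) := by
  have hq1' : 0 < 1 - q := by linarith
  set β := (n : ℝ) - 2 * α with hβ
  set p := 1 / (1 - q) with hp
  have hp1 : 1 ≤ p := by rw [hp, le_div_iff₀ hq1']; linarith
  have hp0 : 0 ≤ p := by linarith
  set b : ℝ≥0∞ := ENNReal.ofReal (2 ^ β) with hb
  have hb1 : 1 ≤ b := by
    rw [hb, ENNReal.one_le_ofReal]; exact Real.one_le_rpow (by norm_num) hαn.le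
  set c : ℝ≥0∞ := (ENNReal.ofReal β * b) ^ p with hc
  have hct : c ≠ ∞ := ENNReal.rpow_ne_top_of_nonneg hp0
    (ENNReal.mul_ne_top ENNReal.ofReal_ne_top ENNReal.ofReal_ne_top)
  set d : ℝ≥0∞ := 2 ^ (p - 1) with hd
  have hdt : d ≠ ∞ := ENNReal.rpow_ne_top_of_nonneg (by linarith) (by simp)
  refine ⟨b + d * (1 + c), ?_, ?_, ?_⟩
  · exact ((zero_lt_one.trans_le hb1).trans_le le_self_add).ne'
  · exact ENNReal.add_ne_top.2 ⟨ENNReal.ofReal_ne_top, ENNReal.mul_ne_top hdt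
      (ENNReal.add_ne_top.2 ⟨ENNReal.one_ne_top, hct⟩)⟩
  intro σ _ x y r hy
  have hyx : dist y x < r := hy
  have hr : 0 < r := dist_nonneg.trans_lt hyx
  set σ' := σ.restrict (Metric.ball x (2 * r)) with hσ'
  -- For radii up to r the measure σ may be replaced by its restriction to B(x,2r); for larger radii
  -- the center moves from y to x at the cost of doubling the radius.
  have hsub1 : ∀ s, s ≤ r → Metric.ball y s ⊆ Metric.ball x (2 * r) := fun s hs =>
    Metric.ball_subset_ball' (by linarith)
  have hsub2 : ∀ s, r < s → Metric.ball y s ⊆ Metric.ball x (2 * s) := fun s hs =>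
    Metric.ball_subset_ball' (by linarith)
  set TK := tailIntegral β (fun s => kappaConst α q σ (Metric.ball x s) ^ (q / (1 - q))) r with hTK
  set Tσ := tailIntegral β (fun s => σ (Metric.ball x s)) r with hTσ
  have hK : intrinsicPotential α q σ y ≤ intrinsicPotential α q σ' y + b * TK := by
    rw [intrinsicPotential_eq_tailIntegral, intrinsicPotential_eq_tailIntegral]
    refine (tailIntegral_le_add hr.le
      (g₁ := fun s => kappaConst α q σ' (Metric.ball y s) ^ (q / (1 - q)))
      (g₂ := fun s => kappaConst α q σ (Metric.ball x (2 * s)) ^ (q / (1 - q)))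
      (fun s _ hs => ?_) fun s hs => ?_).trans ?_
    · rw [kappaConst_restrict Metric.isOpen_ball.measurableSet (hsub1 s hs)]
    · exact ENNReal.rpow_le_rpow (kappaConst_mono hq (hsub2 s hs)) (by positivity)
    · gcongr
      rw [tailIntegral_comp_mul
        (g := fun s => kappaConst α q σ (Metric.ball x s) ^ (q / (1 - q))) (by norm_num) hr.le]
      gcongr
      exact tailIntegral_anti (by linarith)
  have hI : rieszPotential α σ y ≤ rieszPotential α σ' y + ENNReal.ofReal β * b * Tσ := by
    rw [rieszPotential_eq_tailIntegral hαn, rieszPotential_eq_tailIntegral hαn, mul_assoc,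
      ← mul_add]
    gcongr
    refine (tailIntegral_le_add hr.le (g₁ := fun s => σ' (Metric.ball y s))
      (g₂ := fun s => σ (Metric.ball x (2 * s)))
      (fun s _ hs => ?_) fun s hs => measure_mono (hsub2 s hs)).trans ?_
    · rw [hσ', Measure.restrict_apply Metric.isOpen_ball.measurableSet,
        inter_eq_self_of_subset_left (hsub1 s hs)]
    · gcongr
      rw [tailIntegral_comp_mul (g := fun s => σ (Metric.ball x s)) (by norm_num) hr.le]
      gcongr
      exact tailIntegral_anti (by linarith)
  have hIp : rieszPotential α σ y ^ p ≤ d * (rieszPotential α σ' y ^ p + c * Tσ ^ p) := by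
    calc rieszPotential α σ y ^ p
        ≤ (rieszPotential α σ' y + ENNReal.ofReal β * b * Tσ) ^ p := ENNReal.rpow_le_rpow hI hp0
      _ ≤ d * (rieszPotential α σ' y ^ p + (ENNReal.ofReal β * b * Tσ) ^ p) :=
          ENNReal.rpow_add_le_mul_rpow_add_rpow _ _ hp1
      _ = _ := by rw [ENNReal.mul_rpow_of_nonneg _ _ hp0]
  have hA1 : 1 ≤ b + d * (1 + c) := hb1.trans le_self_add
  have hA2 : b ≤ b + d * (1 + c) := le_self_add
  have hA3 : d ≤ b + d * (1 + c) := by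
    calc d ≤ d * (1 + c) := le_mul_of_one_le_right' le_self_add
      _ ≤ _ := le_add_self
  have hA4 : d * c ≤ b + d * (1 + c) := by
    calc d * c ≤ d * (1 + c) := by gcongr; exact le_add_self
      _ ≤ _ := le_add_self
  set A := b + d * (1 + c)
  show intrinsicPotential α q σ y + rieszPotential α σ y ^ p ≤
    A * ((intrinsicPotential α q σ' y + rieszPotential α σ' y ^ p) + (TK + Tσ ^ p))
  calc intrinsicPotential α q σ y + rieszPotential α σ y ^ p
      ≤ (intrinsicPotential α q σ' y + b * TK) +
        d * (rieszPotential α σ' y ^ p + c * Tσ ^ p) := add_le_add hK hIp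
    _ = 1 * intrinsicPotential α q σ' y + b * TK + d * rieszPotential α σ' y ^ p
        + d * c * Tσ ^ p := by ring
    _ ≤ A * intrinsicPotential α q σ' y + A * TK + A * rieszPotential α σ' y ^ p
        + A * Tσ ^ p := by gcongr
    _ = _ := by ring

/-- The local part of the bound function is dominated by any nontrivial supersolution for σ
restricted to B(x,2r), in particular by one whose q-mass is controlled by κ. If κ is infinite there
is nothing to prove. -/
theorem lintegral_ball_boundFunction_rpow_le (hαn : 0 < (n : ℝ) - 2 * α) (hq : 0 < q)
    (hq1 : q < 1) :
    ∃ C : ℝ≥0∞, C ≠ ∞ ∧ ∀ (σ : Measure (Rn n)) [IsLocallyFiniteMeasure σ] (x : Rn n) (r : ℝ),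
      ∫⁻ y in Metric.ball x r, boundFunction α q σ y ^ q ∂σ ≤
        C * (kappaConst α q σ (Metric.ball x (2 * r)) ^ (q / (1 - q)) +
          boundTail α q σ x r ^ q * σ (Metric.ball x r)) := by
  have hq1' : 0 < 1 - q := by linarith
  obtain ⟨A, hA0, hAt, hA⟩ := boundFunction_le_restrict_add_tail hαn hq hq1
  set L := lowerBoundConst n α q
  have hLt : L ≠ ∞ := lowerBoundConst_ne_top hαn hq hq1
  set M : ℝ≥0∞ := 2 ^ (1 / (1 - q))
  have hMt : M ≠ ∞ := ENNReal.rpow_ne_top_of_nonneg (by positivity) (by simp)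
  have hLq : L ^ q ≠ ∞ := ENNReal.rpow_ne_top_of_nonneg hq.le hLt
  have hAq : A ^ q ≠ ∞ := ENNReal.rpow_ne_top_of_nonneg hq.le hAt
  refine ⟨A ^ q * (L ^ q * M + 1), ENNReal.mul_ne_top hAq (ENNReal.add_ne_top.2
    ⟨ENNReal.mul_ne_top hLq hMt, ENNReal.one_ne_top⟩), ?_⟩
  intro σ _ x r
  set B := Metric.ball x (2 * r) with hB
  rcases le_or_gt r 0 with hr | hr
  · rw [Metric.ball_eq_empty.2 hr]; simp
  have hsub : Metric.ball x r ⊆ B := Metric.ball_subset_ball (by linarith)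
  rcases eq_or_ne (kappaConst α q σ B) ∞ with hκ | hκ
  · rw [hκ, ENNReal.top_rpow_of_pos (by positivity), top_add, ENNReal.mul_top]
    · exact le_top
    · exact mul_ne_zero (ENNReal.rpow_pos (pos_iff_ne_zero.2 hA0) hAt).ne' (by simp)
  rcases eq_or_ne (σ B) 0 with hσ0 | hσ0
  · rw [setLIntegral_measure_zero _ _ (measure_mono_null hsub hσ0)]; exact zero_le
  have hσt : σ B ≠ ∞ := measure_ball_lt_top.ne
  obtain ⟨u, hum, hu0, husup, huint⟩ := exists_supersolution_restrict hαn hq hq1 hσ0 hσt hκ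
  have hnt : IsNontrivial (σ.restrict B) u := fun h => by
    have hfalse : ∀ᵐ x ∂(σ.restrict B), False := h.mono fun x hx => hu0 x hx
    rw [ae_iff] at hfalse
    simp [hσ0] at hfalse
  set T := boundTail α q σ x r
  have hpt : ∀ y ∈ Metric.ball x r,
      boundFunction α q σ y ^ q ≤ A ^ q * (L ^ q * u y ^ q + T ^ q) := fun y hy => by
    have h1 : boundFunction α q (σ.restrict B) y ≤ L * u y :=
      (boundFunction_le_of_supersolution hαn hq hq1 hum.aemeasurable
        (ae_of_all _ husup) hnt y).trans (mul_le_mul' le_rfl (husup y))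
    calc boundFunction α q σ y ^ q ≤ (A * (L * u y + T)) ^ q :=
          ENNReal.rpow_le_rpow ((hA σ x y r hy).trans (by gcongr)) hq.le
      _ = A ^ q * (L * u y + T) ^ q := ENNReal.mul_rpow_of_nonneg _ _ hq.le
      _ ≤ A ^ q * ((L * u y) ^ q + T ^ q) := by
          gcongr; exact ENNReal.rpow_add_le_add_rpow _ _ hq.le hq1.le
      _ = _ := by rw [ENNReal.mul_rpow_of_nonneg _ _ hq.le]
  calc ∫⁻ y in Metric.ball x r, boundFunction α q σ y ^ q ∂σ
      ≤ ∫⁻ y in Metric.ball x r, A ^ q * (L ^ q * u y ^ q + T ^ q) ∂σ :=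
        setLIntegral_mono' Metric.isOpen_ball.measurableSet hpt
    _ = A ^ q * (L ^ q * ∫⁻ y in Metric.ball x r, u y ^ q ∂σ + T ^ q * σ (Metric.ball x r)) := by
        rw [lintegral_const_mul' _ _ hAq, lintegral_add_right _ measurable_const,
          lintegral_const_mul' _ _ hLq, setLIntegral_const]
    _ ≤ A ^ q * (L ^ q * (M * kappaConst α q σ B ^ (q / (1 - q))) +
          T ^ q * σ (Metric.ball x r)) := by
        gcongr
        exact (lintegral_mono_set hsub).trans huint
    _ = A ^ q * (L ^ q * M * kappaConst α q σ B ^ (q / (1 - q)) +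
          1 * (T ^ q * σ (Metric.ball x r))) := by ring
    _ ≤ A ^ q * ((L ^ q * M + 1) * kappaConst α q σ B ^ (q / (1 - q)) +
          (L ^ q * M + 1) * (T ^ q * σ (Metric.ball x r))) := by
        gcongr
        · exact le_self_add
        · exact le_add_self
    _ = _ := by ring

/-- Measurability of g allows c = ∞, which occurs where the bound function is infinite. -/
theorem tailIntegral_const_mul_of_measurable {β a : ℝ} {g : ℝ → ℝ≥0∞} (c : ℝ≥0∞)
    (hg : Measurable g) :
    tailIntegral β (fun r => c * g r) a = c * tailIntegral β g a := by
  unfold tailIntegral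
  rw [← lintegral_const_mul _ (by fun_prop)]
  simp only [div_eq_mul_inv, mul_assoc]

/-- The bound function is, up to a constant, a supersolution. -/
theorem rieszPotential_withDensity_le_boundFunction (hαn : 0 < (n : ℝ) - 2 * α) (hq : 0 < q)
    (hq1 : q < 1) :
    ∃ C : ℝ≥0∞, C ≠ ∞ ∧ ∀ (σ : Measure (Rn n)) [IsLocallyFiniteMeasure σ] (f : Rn n → ℝ≥0∞)
      (l : ℝ≥0∞), l ≠ ∞ → (∀ y, f y ≤ l * boundFunction α q σ y) →
      ∀ x, rieszPotential α (σ.withDensity fun y => f y ^ q) x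
        ≤ C * l ^ q * boundFunction α q σ x := by
  have hq1' : 0 < 1 - q := by linarith
  obtain ⟨C, hCt, hC⟩ := lintegral_ball_boundFunction_rpow_le hαn hq hq1
  set β := (n : ℝ) - 2 * α with hβ
  set p := 1 / (1 - q) with hp
  have hp0 : 0 < p := by positivity
  set b : ℝ≥0∞ := ENNReal.ofReal β with hb
  have hb0 : b ≠ 0 := by simpa [hb] using hαn
  have hbt : b ≠ ∞ := ENNReal.ofReal_ne_top
  set c : ℝ≥0∞ := 1 + b⁻¹ ^ p with hc
  have hct : c ≠ ∞ := ENNReal.add_ne_top.2 ⟨ENNReal.one_ne_top,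
    ENNReal.rpow_ne_top_of_nonneg hp0.le (ENNReal.inv_ne_top.2 hb0)⟩
  refine ⟨b * C * (ENNReal.ofReal (2 ^ β) + c ^ q * b⁻¹), ?_, ?_⟩
  · refine ENNReal.mul_ne_top (ENNReal.mul_ne_top hbt hCt) (ENNReal.add_ne_top.2
      ⟨ENNReal.ofReal_ne_top, ENNReal.mul_ne_top ?_ (ENNReal.inv_ne_top.2 hb0)⟩)
    exact ENNReal.rpow_ne_top_of_nonneg hq.le hct
  intro σ _ f l hl hf x
  set v := boundFunction α q σ x with hv
  set K := intrinsicPotential α q σ x with hK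
  set I := rieszPotential α σ x with hI
  have hvdef : v = K + I ^ p := rfl
  have hlq : l ^ q ≠ ∞ := ENNReal.rpow_ne_top_of_nonneg hq.le hl
  have hIt : tailIntegral β (fun r => σ (Metric.ball x r)) 0 = b⁻¹ * I := by
    rw [hI, rieszPotential_eq_tailIntegral hαn, ← mul_assoc, ENNReal.inv_mul_cancel hb0 hbt,
      one_mul]
  have htail : ∀ r, 0 < r → boundTail α q σ x r ≤ c * v := fun r hr => by
    calc boundTail α q σ x r ≤ K + (b⁻¹ * I) ^ p := by
          refine add_le_add (tailIntegral_anti hr.le) ?_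
          rw [← hIt]
          exact ENNReal.rpow_le_rpow (tailIntegral_anti hr.le) hp0.le
      _ = 1 * K + b⁻¹ ^ p * I ^ p := by rw [ENNReal.mul_rpow_of_nonneg _ _ hp0.le, one_mul]
      _ ≤ c * K + c * I ^ p := by
          gcongr
          · exact le_self_add
          · exact le_add_self
      _ = c * v := by rw [hvdef, mul_add]
  -- This makes the tail contribution v^q I at most v, which closes the estimate.
  have hIv : I ≤ v ^ (1 - q) := by
    have h1 : I ^ p ≤ v := le_add_self
    calc I = (I ^ p) ^ (1 - q) := by
          rw [← ENNReal.rpow_mul, hp, one_div_mul_cancel hq1'.ne', ENNReal.rpow_one]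
      _ ≤ _ := ENNReal.rpow_le_rpow h1 hq1'.le
  have hvv : v ^ q * v ^ (1 - q) = v := by
    rw [← ENNReal.rpow_add_of_nonneg _ _ hq.le hq1'.le]; simp
  have hball : ∀ r, 0 < r → (σ.withDensity fun y => f y ^ q) (Metric.ball x r) ≤
      l ^ q * C * (kappaConst α q σ (Metric.ball x (2 * r)) ^ (q / (1 - q)) +
          (c * v) ^ q * σ (Metric.ball x r)) := fun r hr => by
    rw [withDensity_apply _ Metric.isOpen_ball.measurableSet]
    calc ∫⁻ y in Metric.ball x r, f y ^ q ∂σ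
        ≤ ∫⁻ y in Metric.ball x r, l ^ q * boundFunction α q σ y ^ q ∂σ := by
          refine lintegral_mono fun y => ?_
          show f y ^ q ≤ l ^ q * boundFunction α q σ y ^ q
          rw [← ENNReal.mul_rpow_of_nonneg _ _ hq.le]
          exact ENNReal.rpow_le_rpow (hf y) hq.le
      _ = l ^ q * ∫⁻ y in Metric.ball x r, boundFunction α q σ y ^ q ∂σ :=
          lintegral_const_mul' _ _ hlq
      _ ≤ l ^ q * (C * (kappaConst α q σ (Metric.ball x (2 * r)) ^ (q / (1 - q)) +
          boundTail α q σ x r ^ q * σ (Metric.ball x r))) := by gcongr; exact hC σ x r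
      _ ≤ l ^ q * (C * (kappaConst α q σ (Metric.ball x (2 * r)) ^ (q / (1 - q)) +
          (c * v) ^ q * σ (Metric.ball x r))) := by gcongr; exact htail r hr
      _ = _ := by ring
  have hκm : Measurable fun r => kappaConst α q σ (Metric.ball x r) ^ (q / (1 - q)) :=
    (monotone_kappaConst_ball hq hq1 σ x).measurable
  have hσm : Measurable fun r => σ (Metric.ball x r) := (monotone_measure_ball σ x).measurable
  rw [rieszPotential_eq_tailIntegral hαn]
  calc b * tailIntegral β (fun r => (σ.withDensity fun y => f y ^ q) (Metric.ball x r)) 0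
      ≤ b * tailIntegral β (fun r => l ^ q * C *
          (kappaConst α q σ (Metric.ball x (2 * r)) ^ (q / (1 - q)) +
          (c * v) ^ q * σ (Metric.ball x r))) 0 := by
        gcongr
        exact tailIntegral_mono hball
    _ = b * (l ^ q * C * (ENNReal.ofReal (2 ^ β) * K + (c * v) ^ q * (b⁻¹ * I))) := by
        rw [tailIntegral_const_mul _ (ENNReal.mul_ne_top hlq hCt),
          tailIntegral_add
            (g₁ := fun r => kappaConst α q σ (Metric.ball x (2 * r)) ^ (q / (1 - q)))
            (hκm.comp (by fun_prop)), tailIntegral_const_mul_of_measurable _ hσm,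
          hIt, tailIntegral_comp_mul
            (g := fun s => kappaConst α q σ (Metric.ball x s) ^ (q / (1 - q)))
            (by norm_num : (0 : ℝ) < 2) le_rfl, mul_zero]
        rfl
    _ ≤ b * (l ^ q * C * (ENNReal.ofReal (2 ^ β) * v + c ^ q * b⁻¹ * v)) := by
        refine mul_le_mul' le_rfl (mul_le_mul' le_rfl (add_le_add ?_ ?_))
        · exact mul_le_mul' le_rfl le_self_add
        · calc (c * v) ^ q * (b⁻¹ * I) = c ^ q * b⁻¹ * (v ^ q * I) := by
                rw [ENNReal.mul_rpow_of_nonneg _ _ hq.le]; ring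
            _ ≤ c ^ q * b⁻¹ * (v ^ q * v ^ (1 - q)) := by gcongr
            _ = _ := by rw [hvv]
    _ = _ := by ring

end UpperBound

/-! ### Necessity of the tail condition -/

section Tails

variable {n : ℕ} {α q : ℝ}

theorem mul_rpow_le_tailIntegral {β a : ℝ} {g : ℝ → ℝ≥0∞} (hβ : 0 < β) (ha : 0 < a)
    (hg : Monotone g) :
    g a * ENNReal.ofReal a ^ (-β) ≤ ENNReal.ofReal β * tailIntegral β g a := by
  rw [← tailIntegral_one hβ ha, mul_left_comm,
    ← tailIntegral_const_mul_of_measurable _ measurable_const]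
  gcongr
  exact tailIntegral_mono fun r hr => by simpa using hg hr.le

/-- By monotonicity, an infinite value would persist at all larger radii and make the tail infinite.
-/
theorem lt_top_of_tailIntegral_lt_top {β a : ℝ} {g : ℝ → ℝ≥0∞} (hβ : 0 < β) (ha : 0 < a)
    (hg : Monotone g) (h : tailIntegral β g a < ∞) (r : ℝ) : g r < ∞ := by
  set b := max a r with hb
  have hb0 : 0 < b := ha.trans_le (le_max_left _ _)
  refine (hg (le_max_right a r)).trans_lt (lt_top_iff_ne_top.2 fun htop => ?_)
  have h1 := mul_rpow_le_tailIntegral hβ hb0 hg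
  have htop' : g b = ∞ := htop
  rw [htop', ENNReal.top_mul
    (ENNReal.rpow_pos (by simpa using hb0) ENNReal.ofReal_ne_top).ne', top_le_iff] at h1
  exact absurd h1 (ENNReal.mul_ne_top ENNReal.ofReal_ne_top
    ((tailIntegral_anti (le_max_left a r)).trans_lt h).ne)

/-- Continuity from above of the measure with the integrand as density, along the half-lines (k, ∞).
-/
theorem tendsto_tailIntegral_zero {β : ℝ} {g : ℝ → ℝ≥0∞} (h : tailIntegral β g 1 < ∞) :
    Tendsto (fun k : ℕ => tailIntegral β g k) atTop (nhds 0) := by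
  set μ := (volume : Measure ℝ).withDensity
    fun r => g r / ENNReal.ofReal (r ^ β) / ENNReal.ofReal r
  have hμ : ∀ a, μ (Ioi a) = tailIntegral β g a := fun a => withDensity_apply _ measurableSet_Ioi
  have hlim := tendsto_measure_iInter_atTop (μ := μ) (s := fun k : ℕ => Ioi (k : ℝ))
    (fun k => measurableSet_Ioi.nullMeasurableSet)
    (fun i j hij => Ioi_subset_Ioi (by exact_mod_cast hij)) ⟨1, by rw [hμ]; simpa using h.ne⟩
  have hempty : ⋂ k : ℕ, Ioi (k : ℝ) = ∅ := by
    refine eq_empty_of_forall_notMem fun x hx => ?_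
    obtain ⟨k, hk⟩ := exists_nat_gt x
    exact absurd (mem_iInter.1 hx k) (not_lt.2 hk.le)
  rw [hempty, measure_empty] at hlim
  simpa only [Function.comp_def, hμ] using hlim

/-- Finiteness of a Riesz potential at one point yields finiteness of the tail at the origin. -/
theorem tailIntegral_measure_ball_lt_top (hαn : 0 < (n : ℝ) - 2 * α) {ω : Measure (Rn n)}
    [SFinite ω] {x : Rn n} (hx : rieszPotential α ω x < ∞) :
    tailIntegral ((n : ℝ) - 2 * α) (fun r => ω (Metric.ball 0 r)) 1 < ∞ := by
  -- For r > 1 one has r + |x| ≤ (1 + |x|) r, so B(0,r) lies in B(x, l r).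
  set l := 1 + dist 0 x with hl
  have hl0 : 0 < l := by positivity
  rw [rieszPotential_eq_tailIntegral hαn] at hx
  have hx' : tailIntegral ((n : ℝ) - 2 * α) (fun r => ω (Metric.ball x r)) 0 < ∞ :=
    ENNReal.lt_top_of_mul_ne_top_right hx.ne (by simpa using hαn)
  calc tailIntegral ((n : ℝ) - 2 * α) (fun r => ω (Metric.ball 0 r)) 1
      ≤ tailIntegral ((n : ℝ) - 2 * α) (fun r => ω (Metric.ball x (l * r))) 1 := by
        refine tailIntegral_mono fun r hr => measure_mono (Metric.ball_subset_ball' ?_)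
        nlinarith [dist_nonneg (x := (0 : Rn n)) (y := x)]
    _ = ENNReal.ofReal (l ^ ((n : ℝ) - 2 * α)) *
          tailIntegral ((n : ℝ) - 2 * α) (fun r => ω (Metric.ball x r)) (l * 1) :=
        tailIntegral_comp_mul (g := fun r => ω (Metric.ball x r)) hl0 zero_le_one
    _ < ∞ := ENNReal.mul_lt_top ENNReal.ofReal_lt_top
        ((tailIntegral_anti (by positivity)).trans_lt hx')

/-- Finiteness of the q-integral over each closed ball of an exhaustion gives finiteness a.e. on
that ball. -/
theorem ae_lt_top_of_memLqLoc (hq : 0 < q) {σ : Measure (Rn n)} {u : Rn n → ℝ≥0∞}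
    (hu : MemLqLoc q σ u) : ∀ᵐ x ∂σ, u x < ∞ := by
  have h : ∀ k : ℕ, ∀ᵐ x ∂(σ.restrict (Metric.closedBall 0 k)), u x < ∞ := fun k => by
    filter_upwards [ae_lt_top' (hu.1.pow_const q).restrict
      (hu.2 _ (isCompact_closedBall 0 (k : ℝ))).ne] with x hx
    refine lt_top_iff_ne_top.2 fun hxt => ?_
    rw [hxt, ENNReal.top_rpow_of_pos hq] at hx
    exact lt_irrefl _ hx
  have h' := (ae_restrict_iUnion_iff (μ := σ) (fun k : ℕ => Metric.closedBall (0 : Rn n) k)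
    fun x => u x < ∞).2 h
  rwa [Metric.iUnion_closedBall_nat, Measure.restrict_univ] at h'

theorem exists_rieszPotential_lt_top (hq : 0 < q) {σ : Measure (Rn n)} (hσ : σ ≠ 0)
    {u : Rn n → ℝ≥0∞} (hu : IsFracSupersolution α q σ u) :
    ∃ x, rieszPotential α (σ.withDensity fun y => u y ^ q) x < ∞ := by
  have : (ae σ).NeBot := ae_neBot.2 hσ
  obtain ⟨x, hx1, hx2⟩ := ((ae_lt_top_of_memLqLoc hq hu.1).and hu.2).exists
  exact ⟨x, hx2.trans_lt hx1⟩

theorem tailsFinite_iff (σ : Measure (Rn n)) : TailsFinite α q σ ↔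
    tailIntegral ((n : ℝ) - 2 * α)
      (fun r => kappaConst α q σ (Metric.ball 0 r) ^ (q / (1 - q))) 1 < ∞ ∧
    tailIntegral ((n : ℝ) - 2 * α) (fun r => σ (Metric.ball 0 r)) 1 < ∞ :=
  ENNReal.add_lt_top

theorem tailsFinite_of_supersolution (hαn : 0 < (n : ℝ) - 2 * α) (hq : 0 < q) (hq1 : q < 1)
    {σ : Measure (Rn n)} [SigmaFinite σ] (hσ : σ ≠ 0)
    {u : Rn n → ℝ≥0∞} (hu : IsFracSupersolution α q σ u) (hnt : IsNontrivial σ u) :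
    TailsFinite α q σ := by
  have hq1' : 0 < 1 - q := by linarith
  obtain ⟨x, hx⟩ := exists_rieszPotential_lt_top hq hσ hu
  rw [tailsFinite_iff]
  constructor
  · refine lt_of_le_of_lt (tailIntegral_mono fun r _ => kappaConst_rpow_le hαn hq hq1 hu.1.1 hu.2
      hnt Metric.isOpen_ball.measurableSet Metric.isBounded_ball) ?_
    rw [tailIntegral_const_mul _ (kappaBoundConst_ne_top hq hq1)]
    exact ENNReal.mul_lt_top (kappaBoundConst_ne_top hq hq1).lt_top
      (tailIntegral_measure_ball_lt_top hαn hx)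
  · refine tailIntegral_measure_ball_lt_top hαn (x := x) ?_
    have hb : boundFunction α q σ x < ∞ :=
      (boundFunction_le_of_supersolution hαn hq hq1 hu.1.1 hu.2 hnt x).trans_lt
        (ENNReal.mul_lt_top (lowerBoundConst_ne_top hαn hq hq1).lt_top hx)
    have hI : rieszPotential α σ x ^ (1 / (1 - q)) < ∞ := (le_add_self).trans_lt hb
    exact (ENNReal.rpow_lt_top_iff_of_pos (by positivity)).1 hI

end Tails

/-! ### Vanishing lower limit at infinity -/

section Liminf

variable {n : ℕ} {α q : ℝ}

theorem volume_ball_eq (x : Rn n) {r : ℝ} (hr : 0 < r) :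
    volume (Metric.ball x r) = ENNReal.ofReal (r ^ (n : ℝ)) * volume (Metric.ball (0 : Rn n) 1) := by
  rw [Measure.addHaar_ball_of_pos _ _ hr, finrank_euclideanSpace_fin, Real.rpow_natCast]

/-- The potential of Lebesgue measure on a ball. -/
theorem rieszPotential_volume_ball_le (hα : 0 < α) (hαn : 0 < (n : ℝ) - 2 * α) :
    ∃ C : ℝ≥0∞, C ≠ ∞ ∧ ∀ (R : ℝ), 0 < R → ∀ y : Rn n,
      rieszPotential α (volume.restrict (Metric.ball 0 (2 * R))) y ≤
        C * (ENNReal.ofReal R ^ (-((n : ℝ) - 2 * α)) * volume (Metric.ball (0 : Rn n) R)) := by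
  set β := (n : ℝ) - 2 * α with hβ
  have hnβ : (n : ℝ) - β = 2 * α := by rw [hβ]; ring
  refine ⟨ENNReal.ofReal (β / (2 * α)) + ENNReal.ofReal (2 ^ (n : ℝ)),
    ENNReal.add_ne_top.2 ⟨ENNReal.ofReal_ne_top, ENNReal.ofReal_ne_top⟩, ?_⟩
  intro R hR y
  set V := volume (Metric.ball (0 : Rn n) 1) with hV
  have hVt : V ≠ ∞ := measure_ball_lt_top.ne
  set g₁ : ℝ → ℝ≥0∞ := (Iic R).indicator fun r => ENNReal.ofReal (r ^ (n : ℝ)) with hg₁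
  -- Up to radius R the volume grows like r^n; beyond R the whole mass of B(0,2R) is used. Neither
  -- bound depends on y.
  have hsplit : tailIntegral β (fun r => volume.restrict (Metric.ball 0 (2 * R))
      (Metric.ball y r)) 0 ≤ tailIntegral β (fun r => V * g₁ r) 0 +
        tailIntegral β (fun _ => volume (Metric.ball (0 : Rn n) (2 * R)) * 1) R := by
    refine tailIntegral_le_add hR.le (fun r hr hrR => ?_) fun r _ => ?_
    · rw [hg₁, indicator_of_mem (mem_Iic.2 hrR), mul_comm V, ← volume_ball_eq y hr]
      exact Measure.restrict_apply_le _ _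
    · rw [mul_one]
      refine (measure_mono (subset_univ _)).trans ?_
      rw [Measure.restrict_apply_univ]
  have hg : tailIntegral β g₁ 0 = ENNReal.ofReal (R ^ (2 * α) / (2 * α)) := by
    have h1 : tailIntegral β g₁ 0 = ∫⁻ r in Ioc 0 R, ENNReal.ofReal (r ^ (2 * α - 1)) := by
      unfold tailIntegral
      rw [← lintegral_indicator measurableSet_Ioi, ← lintegral_indicator measurableSet_Ioc]
      congr 1
      ext r
      by_cases h0 : 0 < r
      · by_cases hrR : r ≤ R
        · rw [indicator_of_mem (mem_Ioi.2 h0), indicator_of_mem (mem_Ioc.2 ⟨h0, hrR⟩), hg₁,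
            indicator_of_mem (mem_Iic.2 hrR), ← ENNReal.ofReal_div_of_pos (by positivity),
            ← ENNReal.ofReal_div_of_pos h0, ← Real.rpow_sub h0, hnβ, Real.rpow_sub h0,
            Real.rpow_one]
        · rw [indicator_of_mem (mem_Ioi.2 h0), indicator_of_notMem (s := Ioc 0 R) (fun h => hrR h.2), hg₁,
            indicator_of_notMem (s := Iic R) (fun h => hrR h)]
          simp
      · rw [indicator_of_notMem (s := Ioi (0 : ℝ)) (fun h => h0 h),
          indicator_of_notMem (s := Ioc 0 R) (fun h => h0 h.1)]
    rw [h1, ← ofReal_integral_eq_lintegral_ofReal]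
    · rw [← intervalIntegral.integral_of_le hR.le, integral_rpow (Or.inl (by linarith)),
        sub_add_cancel, Real.zero_rpow (by positivity), sub_zero]
    · exact (intervalIntegrable_iff_integrableOn_Ioc_of_le hR.le).1
        (intervalIntegral.intervalIntegrable_rpow' (by linarith))
    · exact (ae_restrict_iff' measurableSet_Ioc).2 (ae_of_all _ fun t ht =>
        Real.rpow_nonneg ht.1.le _)
  have hRα : ENNReal.ofReal (R ^ (2 * α)) =
      ENNReal.ofReal R ^ (-β) * ENNReal.ofReal (R ^ (n : ℝ)) := by
    rw [ENNReal.ofReal_rpow_of_pos hR, ← ENNReal.ofReal_mul (by positivity), ← Real.rpow_add hR]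
    congr 2
    rw [← hnβ]; ring
  rw [rieszPotential_eq_tailIntegral hαn]
  calc ENNReal.ofReal β * tailIntegral β (fun r => volume.restrict (Metric.ball 0 (2 * R))
        (Metric.ball y r)) 0
      ≤ ENNReal.ofReal β * (V * ENNReal.ofReal (R ^ (2 * α) / (2 * α)) +
          volume (Metric.ball (0 : Rn n) (2 * R)) * tailIntegral β (fun _ => 1) R) := by
        gcongr
        refine hsplit.trans (le_of_eq ?_)
        rw [tailIntegral_const_mul _ hVt, tailIntegral_const_mul _ measure_ball_lt_top.ne, hg]
    _ = V * (ENNReal.ofReal β * ENNReal.ofReal (R ^ (2 * α) / (2 * α))) +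
          volume (Metric.ball (0 : Rn n) (2 * R)) *
            (ENNReal.ofReal β * tailIntegral β (fun _ => 1) R) := by ring
    _ = V * (ENNReal.ofReal (β / (2 * α)) * ENNReal.ofReal (R ^ (2 * α))) +
          ENNReal.ofReal (2 ^ (n : ℝ)) * ENNReal.ofReal (R ^ (n : ℝ)) * V *
            ENNReal.ofReal R ^ (-β) := by
        rw [tailIntegral_one hαn hR, volume_ball_eq 0 (by positivity : 0 < 2 * R),
          Real.mul_rpow (by norm_num) hR.le, ENNReal.ofReal_mul (by positivity),
          ← ENNReal.ofReal_mul hαn.le, ← ENNReal.ofReal_mul (div_nonneg hαn.le (by linarith)),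
          div_mul_eq_mul_div, mul_div_assoc]
    _ = _ := by
        rw [hRα, volume_ball_eq 0 hR]; ring

/-- Tonelli's theorem and the symmetry of the kernel. -/
theorem lintegral_rieszPotential_volume (ω : Measure (Rn n)) [SFinite ω] (B : Set (Rn n)) :
    ∫⁻ x in B, rieszPotential α ω x = ∫⁻ y, rieszPotential α (volume.restrict B) y ∂ω := by
  unfold rieszPotential
  rw [lintegral_lintegral_swap (measurable_edist_rpow _).aemeasurable]
  simp_rw [edist_comm]

/-- Averages of a potential over large balls are controlled by the tail of the measure. -/
theorem lintegral_ball_rieszPotential_le (hα : 0 < α) (hαn : 0 < (n : ℝ) - 2 * α) :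
    ∃ C : ℝ≥0∞, C ≠ ∞ ∧ ∀ (ω : Measure (Rn n)) [SFinite ω] (R : ℝ), 0 < R →
      ∫⁻ x in Metric.ball (0 : Rn n) (2 * R), rieszPotential α ω x ≤
        C * tailIntegral ((n : ℝ) - 2 * α) (fun r => ω (Metric.ball 0 r)) R *
          volume (Metric.ball (0 : Rn n) R) := by
  obtain ⟨C, hCt, hC⟩ := rieszPotential_volume_ball_le (n := n) hα hαn
  set β := (n : ℝ) - 2 * α with hβ
  set b := ENNReal.ofReal β
  set c := ENNReal.ofReal ((3 : ℝ) ^ β) with hc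
  set d := ENNReal.ofReal ((2 : ℝ) ^ (n : ℝ))
  refine ⟨C * c * b + b * c * d, ?_, ?_⟩
  · have : b ≠ ∞ := ENNReal.ofReal_ne_top
    have : c ≠ ∞ := ENNReal.ofReal_ne_top
    have : d ≠ ∞ := ENNReal.ofReal_ne_top
    finiteness
  intro ω _ R hR
  set B := Metric.ball (0 : Rn n) (2 * R) with hB
  set V := volume (Metric.ball (0 : Rn n) R) with hV
  set T := tailIntegral β (fun r => ω (Metric.ball 0 r)) R
  set ω' := ω.restrict (Metric.ball 0 (3 * R)) with hω'
  -- As |x| < 2R, balls B(x,s) with s ≤ R stay inside B(0,3R), and those with s > R lie in B(0,3s).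
  -- The first part is then averaged by Tonelli, the second is a tail at the origin.
  have hpt : ∀ x ∈ B, rieszPotential α ω x ≤ rieszPotential α ω' x + b * (c * T) := fun x hx => by
    have hx' : dist x 0 < 2 * R := hx
    rw [rieszPotential_eq_tailIntegral hαn, rieszPotential_eq_tailIntegral hαn, ← mul_add]
    gcongr
    refine (tailIntegral_le_add hR.le (g₁ := fun r => ω' (Metric.ball x r))
      (g₂ := fun r => ω (Metric.ball 0 (3 * r))) (fun s _ hs => ?_) fun s hs => ?_).trans ?_
    · have hsub : Metric.ball x s ⊆ Metric.ball 0 (3 * R) :=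
        Metric.ball_subset_ball' (by linarith)
      rw [hω', Measure.restrict_apply Metric.isOpen_ball.measurableSet,
        inter_eq_self_of_subset_left hsub]
    · exact measure_mono (Metric.ball_subset_ball' (by linarith))
    · gcongr
      rw [tailIntegral_comp_mul (g := fun r => ω (Metric.ball 0 r)) (by norm_num) hR.le]
      gcongr
      exact tailIntegral_anti (by linarith)
  have hmass : ENNReal.ofReal R ^ (-β) * ω (Metric.ball 0 (3 * R)) ≤ c * b * T := by
    have h3 : ENNReal.ofReal R ^ (-β) = c * ENNReal.ofReal (3 * R) ^ (-β) := by
      rw [ENNReal.ofReal_rpow_of_pos hR, ENNReal.ofReal_rpow_of_pos (by positivity), hc,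
        ← ENNReal.ofReal_mul (by positivity), Real.mul_rpow (by norm_num) hR.le, ← mul_assoc,
        ← Real.rpow_add (by norm_num), add_neg_cancel, Real.rpow_zero, one_mul]
    have h := mul_rpow_le_tailIntegral hαn (by positivity : 0 < 3 * R)
      (monotone_measure_ball ω 0)
    calc _ = c * (ω (Metric.ball 0 (3 * R)) * ENNReal.ofReal (3 * R) ^ (-β)) := by
          rw [h3]; ring
      _ ≤ c * (b * T) := by
          exact mul_le_mul' le_rfl (h.trans (mul_le_mul' le_rfl (tailIntegral_anti (by linarith))))
      _ = _ := by ring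
  have hvol : volume B = d * V := by
    rw [hB, hV, volume_ball_eq 0 (by positivity), volume_ball_eq 0 hR,
      Real.mul_rpow (by norm_num) hR.le, ENNReal.ofReal_mul (by positivity), mul_assoc]
  calc ∫⁻ x in B, rieszPotential α ω x
      ≤ ∫⁻ x in B, (rieszPotential α ω' x + b * (c * T)) :=
        setLIntegral_mono' Metric.isOpen_ball.measurableSet hpt
    _ = ∫⁻ y, rieszPotential α (volume.restrict B) y ∂ω' + b * (c * T) * (d * V) := by
        rw [lintegral_add_right _ measurable_const, setLIntegral_const, hvol,
          lintegral_rieszPotential_volume]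
    _ ≤ C * (ENNReal.ofReal R ^ (-β) * V) * ω (Metric.ball 0 (3 * R)) +
          b * (c * T) * (d * V) := by
        gcongr
        refine (lintegral_mono fun y => hC R hR y).trans ?_
        rw [lintegral_const, hω', Measure.restrict_apply_univ]
    _ = C * (ENNReal.ofReal R ^ (-β) * ω (Metric.ball 0 (3 * R))) * V +
          b * c * d * T * V := by ring
    _ ≤ C * (c * b * T) * V + b * c * d * T * V := by gcongr
    _ = _ := by ring

/-- A Riesz potential with finite tail has vanishing lower limit at infinity. -/
theorem liminf_rieszPotential_eq_zero (hα : 0 < α) (hαn : 0 < (n : ℝ) - 2 * α)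
    {ω : Measure (Rn n)} [SFinite ω]
    (hω : tailIntegral ((n : ℝ) - 2 * α) (fun r => ω (Metric.ball 0 r)) 1 < ∞) :
    liminf (rieszPotential α ω) (cocompact (Rn n)) = 0 := by
  obtain ⟨C, hCt, hC⟩ := lintegral_ball_rieszPotential_le (n := n) hα hαn
  have hn : (1 : ℝ) ≤ n := by
    have : (0 : ℝ) < n := by linarith
    exact_mod_cast this
  rw [← nonpos_iff_eq_zero]
  refine le_of_forall_gt fun ε hε => ?_
  obtain ⟨δ, hδ0, hδε⟩ := exists_between hε
  refine lt_of_le_of_lt ?_ hδε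
  refine liminf_le_of_frequently_le' ?_
  intro hev
  have hev' : ∀ᶠ x in cocompact (Rn n), δ ≤ rieszPotential α ω x := hev.mono fun x hx =>
    (not_le.1 hx).le
  rw [← Metric.cobounded_eq_cocompact] at hev'
  obtain ⟨R₀, -, hR₀⟩ := (Metric.hasBasis_cobounded_compl_closedBall (0 : Rn n)).mem_iff.1 hev'
  have hlim : Tendsto (fun k : ℕ => C * tailIntegral ((n : ℝ) - 2 * α)
      (fun r => ω (Metric.ball 0 r)) k) atTop (nhds (C * 0)) :=
    ENNReal.Tendsto.const_mul (tendsto_tailIntegral_zero hω) (Or.inr hCt)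
  rw [mul_zero] at hlim
  refine absurd hδ0 (not_lt.2 (ge_of_tendsto hlim ?_))
  obtain ⟨N, hN⟩ := exists_nat_gt (max R₀ 0)
  filter_upwards [eventually_ge_atTop N] with k hk
  have hNk : (N : ℝ) ≤ k := by exact_mod_cast hk
  have hkR : R₀ < k := (le_max_left _ _).trans_lt (hN.trans_le hNk)
  have hk0 : (0 : ℝ) < k := (le_max_right _ _).trans_lt (hN.trans_le hNk)
  set V := volume (Metric.ball (0 : Rn n) k) with hV
  have hV0 : V ≠ 0 := (Metric.measure_ball_pos _ _ hk0).ne'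
  have hVt : V ≠ ∞ := measure_ball_lt_top.ne
  -- If the potential were at least δ > 0 near infinity, its average over this annulus would be too.
  -- Since n ≥ 1, the annulus has at least the volume of B(0,k), so δ is at most a constant times
  -- the tail beyond k, which tends to 0.
  set A := Metric.ball (0 : Rn n) (2 * k) \ Metric.ball 0 k with hA
  have hAm : MeasurableSet A := Metric.isOpen_ball.measurableSet.diff
    Metric.isOpen_ball.measurableSet
  have hAV : V ≤ volume A := by
    have h1 : V + V ≤ V + volume A := by
      calc V + V = ENNReal.ofReal ((2 : ℝ) ^ (1 : ℝ)) * V := by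
            rw [Real.rpow_one, ENNReal.ofReal_ofNat, two_mul]
        _ ≤ ENNReal.ofReal ((2 : ℝ) ^ (n : ℝ)) * V := by
            gcongr
            norm_num
        _ = volume (Metric.ball (0 : Rn n) (2 * k)) := by
            rw [hV, volume_ball_eq 0 (by positivity : (0 : ℝ) < 2 * k), volume_ball_eq 0 hk0,
              Real.mul_rpow (by norm_num) hk0.le, ENNReal.ofReal_mul (by positivity), mul_assoc]
        _ ≤ volume (Metric.ball (0 : Rn n) (2 * k) ∩ Metric.ball 0 k) + volume A :=
            measure_le_inter_add_sdiff _ _ _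
        _ ≤ V + volume A := add_le_add (measure_mono inter_subset_right) le_rfl
    exact (ENNReal.add_le_add_iff_left hVt).1 h1
  have hmain : δ * V ≤ C * tailIntegral ((n : ℝ) - 2 * α) (fun r => ω (Metric.ball 0 r)) k * V := by
    calc δ * V ≤ δ * volume A := by gcongr
      _ = ∫⁻ _ in A, δ := (setLIntegral_const _ _).symm
      _ ≤ ∫⁻ x in A, rieszPotential α ω x := by
          refine setLIntegral_mono' hAm fun x hx => hR₀ ?_
          have hx2 : ¬ dist x 0 < k := hx.2
          show ¬ dist x 0 ≤ R₀
          intro h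
          exact hx2 (h.trans_lt hkR)
      _ ≤ ∫⁻ x in Metric.ball (0 : Rn n) (2 * k), rieszPotential α ω x :=
          lintegral_mono_set sdiff_subset
      _ ≤ _ := hC ω k hk0
  exact (ENNReal.mul_le_mul_iff_left hV0 hVt).1 hmain

end Liminf

/-! ### Construction of the minimal solution -/

section Minimal

variable {n : ℕ} {α q : ℝ}

/-- The map `f ↦ I_{2α}(f^q dσ)`. -/
noncomputable def potentialMap (α q : ℝ) (σ : Measure (Rn n)) (f : Rn n → ℝ≥0∞) :
    Rn n → ℝ≥0∞ :=
  fun x => rieszPotential α (σ.withDensity fun y => f y ^ q) x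

theorem potentialMap_mono (hq : 0 ≤ q) (σ : Measure (Rn n)) : Monotone (potentialMap α q σ) :=
  fun _ _ h x => rieszPotential_withDensity_mono hq (ae_of_all _ h) x

/-- The constant in the lower bound by `(I_{2α} σ)^{1/(1-q)}`. -/
noncomputable def potentialConst (n : ℕ) (α q : ℝ) : ℝ≥0∞ :=
  (2 ^ ((1 + ((n : ℝ) - 2 * α)) / (1 - q))) ^ (1 / (1 - q))

theorem potentialConst_ne_top (hαn : 0 < (n : ℝ) - 2 * α) (hq1 : q < 1) :
    potentialConst n α q ≠ ∞ := by
  have hq1' : 0 < 1 - q := by linarith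
  exact ENNReal.rpow_ne_top_of_nonneg (by positivity)
    (ENNReal.rpow_ne_top_of_nonneg (by positivity) (by simp))

theorem potentialConst_ne_zero (hαn : 0 < (n : ℝ) - 2 * α) (hq1 : q < 1) :
    potentialConst n α q ≠ 0 := by
  have hq1' : 0 < 1 - q := by linarith
  exact (ENNReal.rpow_pos (ENNReal.rpow_pos (by norm_num) (by simp))
    (ENNReal.rpow_ne_top_of_nonneg (by positivity) (by simp))).ne'

/-- The first iterate in the construction of the minimal solution. -/
noncomputable def initialFunction (α q : ℝ) (σ : Measure (Rn n)) (x : Rn n) : ℝ≥0∞ :=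
  (potentialConst n α q)⁻¹ * rieszPotential α σ x ^ (1 / (1 - q))

theorem measurable_initialFunction (σ : Measure (Rn n)) [SFinite σ] :
    Measurable (initialFunction α q σ) :=
  ((measurable_rieszPotential σ).pow_const _).const_mul _

/-- The iterated potential inequality with t = q/(1-q) makes the initial function a subsolution:
multiplying by D⁻¹ scales the two sides by D⁻¹ and D^{-q}, and D^{1-q} absorbs the constant. -/
theorem initialFunction_le (hαn : 0 < (n : ℝ) - 2 * α) (hq : 0 < q) (hq1 : q < 1)
    (σ : Measure (Rn n)) [SigmaFinite σ] :
    initialFunction α q σ ≤ potentialMap α q σ (initialFunction α q σ) := by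
  intro x
  have hq1' : 0 < 1 - q := by linarith
  set D := potentialConst n α q with hD
  have hD0 : D ≠ 0 := potentialConst_ne_zero hαn hq1
  have hDt : D ≠ ∞ := potentialConst_ne_top hαn hq1
  set β := (n : ℝ) - 2 * α with hβ
  set t := q / (1 - q) with ht
  have ht0 : 0 ≤ t := by positivity
  have h1t : 1 + t = 1 / (1 - q) := by rw [ht]; field_simp; ring
  have hiter := rieszPotential_rpow_le hαn σ ht0 x
  have hDq : (2 : ℝ≥0∞) ^ (1 + t + β * t) ≤ D ^ (1 - q) := by
    rw [hD, potentialConst, ← ENNReal.rpow_mul, one_div_mul_cancel hq1'.ne', ENNReal.rpow_one]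
    refine ENNReal.rpow_le_rpow_of_exponent_le (by norm_num) ?_
    rw [h1t, ht, ← hβ, mul_div_assoc', ← add_div]
    gcongr
    nlinarith
  have hDD : D⁻¹ * D ^ (1 - q) = D⁻¹ ^ q := by
    rw [ENNReal.inv_rpow, ← ENNReal.rpow_neg_one, ← ENNReal.rpow_neg,
      ← ENNReal.rpow_add _ _ hD0 hDt]
    congr 1; ring
  show D⁻¹ * rieszPotential α σ x ^ (1 / (1 - q)) ≤ _
  unfold potentialMap
  rw [rieszPotential_withDensity ((measurable_initialFunction σ).pow_const q).aemeasurable]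
  rw [h1t] at hiter
  calc D⁻¹ * rieszPotential α σ x ^ (1 / (1 - q))
      ≤ D⁻¹ * (D ^ (1 - q) *
        ∫⁻ y, edist x y ^ (2 * α - (n : ℝ)) * rieszPotential α σ y ^ t ∂σ) := by
        gcongr
        refine hiter.trans ?_
        rw [← h1t]
        gcongr
    _ = ∫⁻ y, edist x y ^ (2 * α - (n : ℝ)) * initialFunction α q σ y ^ q ∂σ := by
        rw [← mul_assoc, hDD, ← lintegral_const_mul' _ _
          (ENNReal.rpow_ne_top_of_nonneg hq.le (ENNReal.inv_ne_top.2 hD0))]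
        refine lintegral_congr fun y => ?_
        rw [initialFunction, ENNReal.mul_rpow_of_nonneg _ _ hq.le, ← ENNReal.rpow_mul,
          show 1 / (1 - q) * q = t by rw [ht]; ring]
        ring

/-- The minimal solution, as the limit of the iterates of `f ↦ I_{2α}(f^q dσ)`. -/
noncomputable def minimalSolution (α q : ℝ) (σ : Measure (Rn n)) (x : Rn n) : ℝ≥0∞ :=
  ⨆ k : ℕ, (potentialMap α q σ)^[k] (initialFunction α q σ) x

section Iterates

variable {σ : Measure (Rn n)}

theorem monotone_iterates (hαn : 0 < (n : ℝ) - 2 * α) (hq : 0 < q) (hq1 : q < 1)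
    (σ : Measure (Rn n)) [SigmaFinite σ] :
    Monotone fun k : ℕ => (potentialMap α q σ)^[k] (initialFunction α q σ) :=
  (potentialMap_mono hq.le σ).monotone_iterate_of_le_map (initialFunction_le hαn hq hq1 σ)

theorem measurable_iterates (σ : Measure (Rn n)) [SFinite σ] (k : ℕ) :
    Measurable ((potentialMap α q σ)^[k] (initialFunction α q σ)) := by
  cases k with
  | zero => exact measurable_initialFunction σ
  | succ k =>
    rw [Function.iterate_succ_apply']
    exact measurable_rieszPotential _

theorem measurable_minimalSolution (σ : Measure (Rn n)) [SFinite σ] :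
    Measurable (minimalSolution α q σ) :=
  Measurable.iSup (measurable_iterates σ)

theorem minimalSolution_eq (hαn : 0 < (n : ℝ) - 2 * α) (hq : 0 < q) (hq1 : q < 1)
    (σ : Measure (Rn n)) [SigmaFinite σ] (x : Rn n) :
    minimalSolution α q σ x =
      rieszPotential α (σ.withDensity fun y => minimalSolution α q σ y ^ q) x := by
  have hmono := monotone_iterates hαn hq hq1 σ
  unfold minimalSolution
  rw [rieszPotential_iSup hq (measurable_iterates σ) hmono]
  have hx : Monotone fun k : ℕ => (potentialMap α q σ)^[k] (initialFunction α q σ) x :=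
    fun i j hij => hmono hij x
  -- Dropping the first iterate does not change the supremum of an increasing sequence.
  rw [← hx.iSup_nat_add 1]
  simp_rw [Function.iterate_succ_apply']
  rfl

theorem minimalSolution_pos (hαn : 0 < (n : ℝ) - 2 * α) (hq1 : q < 1) (hσ : σ ≠ 0) (x : Rn n) :
    0 < minimalSolution α q σ x := by
  have hq1' : 0 < 1 - q := by linarith
  refine lt_of_lt_of_le ?_ (le_iSup
    (fun k : ℕ => (potentialMap α q σ)^[k] (initialFunction α q σ) x) 0)
  exact ENNReal.mul_pos (ENNReal.inv_ne_zero.2 (potentialConst_ne_top hαn hq1))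
    (ENNReal.rpow_pos_of_nonneg (rieszPotential_pos hαn hσ x) (by positivity)).ne'

/-- The universal lower bound places the initial function below w; monotonicity of the potential map
and the equation for w propagate this to all iterates. -/
theorem minimalSolution_le (hαn : 0 < (n : ℝ) - 2 * α) (hq : 0 < q) (hq1 : q < 1)
    [SigmaFinite σ] {w : Rn n → ℝ≥0∞} (hw : IsFracSolution α q σ w) (hnt : IsNontrivial σ w)
    (x : Rn n) : minimalSolution α q σ x ≤ w x := by
  refine iSup_le fun k => ?_
  revert x
  induction k with
  | zero =>
    intro x
    have h := rieszPotential_rpow_le_of_supersolution hαn hq hq1 hw.1.1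
      (ae_of_all _ fun x => (hw.2 x).ge) hnt x
    rw [← hw.2 x] at h
    show (potentialConst n α q)⁻¹ * _ ≤ _
    rw [ENNReal.inv_mul_le_iff (potentialConst_ne_zero hαn hq1) (potentialConst_ne_top hαn hq1)]
    exact h
  | succ k ih =>
    intro x
    rw [Function.iterate_succ_apply', hw.2 x]
    exact potentialMap_mono hq.le σ ih x

end Iterates

theorem minimalSolution_le_boundFunction (hαn : 0 < (n : ℝ) - 2 * α) (hq : 0 < q) (hq1 : q < 1) :
    ∃ l : ℝ≥0∞, l ≠ ∞ ∧ ∀ (σ : Measure (Rn n)) [IsLocallyFiniteMeasure σ] (x : Rn n),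
      minimalSolution α q σ x ≤ l * boundFunction α q σ x := by
  have hq1' : 0 < 1 - q := by linarith
  obtain ⟨C, hCt, hC⟩ := rieszPotential_withDensity_le_boundFunction (n := n) hαn hq hq1
  set D := potentialConst n α q
  have hDi : D⁻¹ ≠ ∞ := ENNReal.inv_ne_top.2 (potentialConst_ne_zero hαn hq1)
  -- The first term covers the initial function; the second gives C l^q ≤ l, so the bound by l times
  -- the bound function is preserved by iteration. This is where sublinearity enters.
  set l : ℝ≥0∞ := D⁻¹ + C ^ (1 / (1 - q)) with hl
  have hlt : l ≠ ∞ := ENNReal.add_ne_top.2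
    ⟨hDi, ENNReal.rpow_ne_top_of_nonneg (by positivity) hCt⟩
  have hCl : C * l ^ q ≤ l := by
    have h1 : C ≤ l ^ (1 - q) := by
      calc C = (C ^ (1 / (1 - q))) ^ (1 - q) := by
            rw [← ENNReal.rpow_mul, one_div_mul_cancel hq1'.ne', ENNReal.rpow_one]
        _ ≤ _ := ENNReal.rpow_le_rpow le_add_self hq1'.le
    calc C * l ^ q ≤ l ^ (1 - q) * l ^ q := by gcongr
      _ = l := by rw [← ENNReal.rpow_add_of_nonneg _ _ hq1'.le hq.le]; simp
  refine ⟨l, hlt, fun σ _ x => iSup_le fun k => ?_⟩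
  revert x
  induction k with
  | zero =>
    intro x
    show D⁻¹ * _ ≤ _
    exact mul_le_mul' le_self_add le_add_self
  | succ k ih =>
    intro x
    rw [Function.iterate_succ_apply']
    exact (hC σ _ l hlt ih x).trans (mul_le_mul' hCl le_rfl)

/-- A compact set lies in a ball B(0,r) with r ≥ 1. There the integral bound involves only
κ(B(0,2r)), the tails at the origin and σ(B(0,r)), all finite under the tail condition. -/
theorem memLqLoc_of_le_boundFunction (hαn : 0 < (n : ℝ) - 2 * α) (hq : 0 < q) (hq1 : q < 1)
    {σ : Measure (Rn n)} [IsLocallyFiniteMeasure σ] (hσ : TailsFinite α q σ)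
    {u : Rn n → ℝ≥0∞} (hu : Measurable u) {l : ℝ≥0∞} (hl : l ≠ ∞)
    (hle : ∀ x, u x ≤ l * boundFunction α q σ x) : MemLqLoc q σ u := by
  have hq1' : 0 < 1 - q := by linarith
  refine ⟨hu.aemeasurable, fun A hA => ?_⟩
  obtain ⟨R, hR⟩ := hA.isBounded.subset_ball 0
  obtain ⟨C, hCt, hC⟩ := lintegral_ball_boundFunction_rpow_le (n := n) hαn hq hq1
  rw [tailsFinite_iff] at hσ
  obtain ⟨hσ1, hσ2⟩ := hσ
  set r := max 1 R with hr
  have hr1 : 1 ≤ r := le_max_left _ _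
  have hlq : l ^ q ≠ ∞ := ENNReal.rpow_ne_top_of_nonneg hq.le hl
  have hκ : kappaConst α q σ (Metric.ball 0 (2 * r)) ^ (q / (1 - q)) < ∞ :=
    lt_top_of_tailIntegral_lt_top hαn one_pos (monotone_kappaConst_ball hq hq1 σ 0) hσ1 _
  have hT : boundTail α q σ 0 r < ∞ := ENNReal.add_lt_top.2
    ⟨(tailIntegral_anti hr1).trans_lt hσ1, ENNReal.rpow_lt_top_of_nonneg (by positivity)
      ((tailIntegral_anti hr1).trans_lt hσ2).ne⟩
  calc ∫⁻ x in A, u x ^ q ∂σ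
      ≤ ∫⁻ x in Metric.ball 0 r, u x ^ q ∂σ :=
        lintegral_mono_set (hR.trans (Metric.ball_subset_ball (le_max_right _ _)))
    _ ≤ ∫⁻ x in Metric.ball 0 r, l ^ q * boundFunction α q σ x ^ q ∂σ := by
        refine lintegral_mono fun x => ?_
        show u x ^ q ≤ l ^ q * boundFunction α q σ x ^ q
        rw [← ENNReal.mul_rpow_of_nonneg _ _ hq.le]
        exact ENNReal.rpow_le_rpow (hle x) hq.le
    _ = l ^ q * ∫⁻ x in Metric.ball 0 r, boundFunction α q σ x ^ q ∂σ :=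
        lintegral_const_mul' _ _ hlq
    _ ≤ l ^ q * (C * (kappaConst α q σ (Metric.ball 0 (2 * r)) ^ (q / (1 - q)) +
          boundTail α q σ 0 r ^ q * σ (Metric.ball 0 r))) := by gcongr; exact hC σ 0 r
    _ < ∞ := by
        refine ENNReal.mul_lt_top hlq.lt_top (ENNReal.mul_lt_top hCt.lt_top
          (ENNReal.add_lt_top.2 ⟨hκ, ENNReal.mul_lt_top ?_ measure_ball_lt_top⟩))
        exact ENNReal.rpow_lt_top_of_nonneg hq.le hT.ne

end Minimal

/-! ### The main theorem -/

theorem theorem1p3 (n : ℕ) (α q : ℝ) (hα : 0 < α) (hαn : α < (n : ℝ) / 2)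
    (hq : 0 < q) (hq1 : q < 1) :
    ∃ c : ℝ≥0, 0 < c ∧
      ∀ σ : Measure (EuclideanSpace ℝ (Fin n)), IsLocallyFiniteMeasure σ → σ ≠ 0 →
        (TailsFinite α q σ →
          ∃ u : EuclideanSpace ℝ (Fin n) → ℝ≥0∞,
            IsFracSolution α q σ u ∧
            (∀ x, 0 < u x) ∧
            liminf u (cocompact (EuclideanSpace ℝ (Fin n))) = 0 ∧
            (∀ x, (c : ℝ≥0∞)⁻¹ * boundFunction α q σ x ≤ u x ∧
              u x ≤ (c : ℝ≥0∞) * boundFunction α q σ x) ∧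
            (∀ w : EuclideanSpace ℝ (Fin n) → ℝ≥0∞,
              IsFracSolution α q σ w → IsNontrivial σ w → ∀ x, u x ≤ w x)) ∧
        (∀ u : EuclideanSpace ℝ (Fin n) → ℝ≥0∞,
          IsFracSupersolution α q σ u → IsNontrivial σ u →
            TailsFinite α q σ ∧
            (∀ᵐ x ∂σ, (c : ℝ≥0∞)⁻¹ * boundFunction α q σ x ≤ u x) ∧
            ((∀ x, rieszPotential α (σ.withDensity fun y => u y ^ q) x ≤ u x) →
              ∀ x, (c : ℝ≥0∞)⁻¹ * boundFunction α q σ x ≤ u x)) := by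
  have hβ : 0 < (n : ℝ) - 2 * α := by linarith
  obtain ⟨l, hlt, hl⟩ := minimalSolution_le_boundFunction (n := n) hβ hq hq1
  set L := lowerBoundConst n α q
  have hLt : L ≠ ∞ := lowerBoundConst_ne_top hβ hq hq1
  -- One constant for everything: l serves the upper bound, L the lower bounds, and 1 ensures
  -- positivity.
  have hct : 1 + l + L ≠ ∞ :=
    ENNReal.add_ne_top.2 ⟨ENNReal.add_ne_top.2 ⟨ENNReal.one_ne_top, hlt⟩, hLt⟩
  have hc0 : 0 < 1 + l + L := lt_of_lt_of_le one_pos (le_self_add.trans le_self_add)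
  refine ⟨(1 + l + L).toNNReal, ENNReal.toNNReal_pos hc0.ne' hct, ?_⟩
  rw [ENNReal.coe_toNNReal hct]
  intro σ hσf hσ
  have hlower : ∀ {u : Rn n → ℝ≥0∞}, AEMeasurable u σ →
      (∀ᵐ x ∂σ, rieszPotential α (σ.withDensity fun y => u y ^ q) x ≤ u x) → IsNontrivial σ u →
      ∀ x, (1 + l + L)⁻¹ * boundFunction α q σ x ≤
        rieszPotential α (σ.withDensity fun y => u y ^ q) x := fun hu hsup hnt x => by
    rw [ENNReal.inv_mul_le_iff hc0.ne' hct]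
    exact (boundFunction_le_of_supersolution hβ hq hq1 hu hsup hnt x).trans
      (mul_le_mul' le_add_self le_rfl)
  constructor
  · intro htails
    have hmeas := measurable_minimalSolution (α := α) (q := q) σ
    have heq := minimalSolution_eq hβ hq hq1 σ
    have hloc := memLqLoc_of_le_boundFunction hβ hq hq1 htails hmeas hlt (hl σ)
    have hpos := minimalSolution_pos (q := q) hβ hq1 hσ
    have hnt : IsNontrivial σ (minimalSolution α q σ) := fun h => by
      have : (ae σ).NeBot := ae_neBot.2 hσ
      obtain ⟨x, hx⟩ := h.exists
      exact (hpos x).ne' hx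
    have hsup : ∀ᵐ x ∂σ, rieszPotential α
        (σ.withDensity fun y => minimalSolution α q σ y ^ q) x ≤ minimalSolution α q σ x :=
      ae_of_all _ fun x => (heq x).ge
    refine ⟨minimalSolution α q σ, ⟨hloc, heq⟩, hpos, ?_, fun x => ⟨?_, ?_⟩,
      fun w hw hwnt => minimalSolution_le hβ hq hq1 hw hwnt⟩
    -- The solution is finite at some point, and this finiteness gives the finite tail of u^q dσ
    -- needed for the lower limit.
    · obtain ⟨x, hx⟩ := exists_rieszPotential_lt_top hq hσ ⟨hloc, hsup⟩
      rw [show minimalSolution α q σ =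
        rieszPotential α (σ.withDensity fun y => minimalSolution α q σ y ^ q) from funext heq]
      exact liminf_rieszPotential_eq_zero hα hβ (tailIntegral_measure_ball_lt_top hβ hx)
    · exact (hlower hmeas.aemeasurable hsup hnt x).trans (heq x).ge
    · exact (hl σ x).trans (mul_le_mul' (le_add_self.trans le_self_add) le_rfl)
  · intro u hu hnt
    refine ⟨tailsFinite_of_supersolution hβ hq hq1 hσ hu hnt, ?_, fun hall x => ?_⟩
    · exact hu.2.mono fun x hx => (hlower hu.1.1 hu.2 hnt x).trans hx
    · exact (hlower hu.1.1 hu.2 hnt x).trans (hall x)
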